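/- Let $A$ be a Banach algebra over $\mathbb{K}=\mathbb{R}$ or $\mathbb{C}$ (not necessarily unital), let $G$ be a locally compact Hausdorff group with left Haar measure $ds$ and modular function $\Delta$ (normalised by $\Delta(r)\int_G h(sr)\,ds=\int_G h(s)\,ds$ for $h\in C_c(G)$), and let $\alpha$ be a strongly continuous action of $G$ on $A$ by bounded algebra automorphisms. Assume that for each $\varepsilon>0$ the algebra $A$ has a $(1+\varepsilon)$-bounded approximate left identity, i.e. a net $(u_i)$ in $A$ with $\|u_i\|\le 1+\varepsilon$ and $u_ia\to a$ for all $a\in A$. A continuous covariant representation of $(A,G,\alpha)$ on a Banach space $X$ is a pair $(\pi,U)$ of a bounded algebra homomorphism $\pi:A\to B(X)$ and a strongly continuous homomorphism $U$ of $G$ into the invertible elements of $B(X)$ such that $\pi(\alpha_s(a))=U_s\pi(a)U_s^{-1}$ for all $a\in A$, $s\in G$. A representation $T$ of an algebra on $X$ is non-degenerate if the linear span of all $T(b)x$ is dense in $X$, and $(\pi,U)$ is non-degenerate if $\pi$ is. Let $\mathcal{X}$ be a class of Banach spaces over $\mathbb K$, and let $\mathcal{R}$ consist of all non-degenerate continuous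 covariant representations $(\pi,U)$ of $(A,G,\alpha)$ on spaces from $\mathcal{X}$ such that $\pi$ is contractive and $U_r$ is an isometry for all $r\in G$. Suppose that $\mathcal{R}$ is non-empty. Equip $C_c(G,A)$ with the product $(f*g)(s)=\int_G f(r)\,\alpha_r(g(r^{-1}s))\,dr$. For $(\pi,U)\in\mathcal{R}$ put $\pi\rtimes U(f)=\int_G\pi(f(s))U_s\,ds$ (strongly convergent integral), and let $\sigma^{\mathcal{R}}(f)=\sup_{(\pi,U)\in\mathcal{R}}\|\pi\rtimes U(f)\|$, which is an algebra seminorm. The crossed product $(A\rtimes_\alpha G)^{\mathcal{R}}$ is the Banach algebra obtained by completing $C_c(G,A)/\ker\sigma^{\mathcal{R}}$ in the norm induced by $\sigma^{\mathcal{R}}$; let $q^{\mathcal{R}}$ be the canonical map of $C_c(G,A)$ into it. For $(\pi,U)\in\mathcal{R}$ let $(\pi\rtimes U)^{\mathcal{R}}$ be the contractive representation of $(A\rtimes_\alpha G)^{\mathcal{R}}$ determined by $(\pi\rtimes U)^{\mathcal{R}}(q^{\mathcal{R}}(f))=\pi\rtimes U(f)$. Then the map $(\pi,U)\mapsto(\pi\rtimes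 U)^{\mathcal{R}}$ is a bijection between $\mathcal{R}$ and the non-degenerate contractive representations of $(A\rtimes_\alpha G)^{\mathcal{R}}$ on spaces from $\mathcal{X}$. It preserves the set of closed invariant subspaces (a closed subspace is invariant under all $\pi(a)$ and all $U_s$ if and only if it is invariant under $(\pi\rtimes U)^{\mathcal{R}}$), as well as the space of bounded intertwining operators between two elements of $\mathcal{R}$ (a bounded operator intertwines $(\pi,U)$ and $(\rho,V)$, i.e. intertwines both $\pi$ with $\rho$ and $U$ with $V$, if and only if it intertwines $(\pi\rtimes U)^{\mathcal{R}}$ and $(\rho\rtimes V)^{\mathcal{R}}$). Moreover, suppose that $A$ has a bounded (conjugate-linear) involution, that each $\alpha_s$ is involutive, and that every $(\pi,U)\in\mathcal{R}$ is involutive, i.e. its space is a Hilbert space, $\pi(a^*)=\pi(a)^*$ for all $a\in A$, and every $U_s$ is unitary. Then the bijection preserves the property of being involutive, where $(A\rtimes_\alpha G)^{\mathcal{R}}$ carries the continuous extension of the involution induced by $f^*(s)=\Delta(s^{-1})\,\alpha_s(f(s^{-1})^*)$ on $C_c(G,A)$, and a representation $T$ of it on a Hilbert space is involutive if $T(b^*)=T(b)^*$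 for all $b$. -/

import Mathlib

open MeasureTheory Filter Topology Set
open scoped CompactlySupported

universe v w

namespace CrossedProd

section Integral

variable (𝕜 : Type*) [RCLike 𝕜] {G : Type*} [MeasurableSpace G]
  {E : Type*} [NormedAddCommGroup E] [NormedSpace 𝕜 E]
  {F : Type*} [NormedAddCommGroup F] [NormedSpace 𝕜 F]

/-- The Bochner integral over `G` of a function with values in a normed space over `𝕜`, which is
viewed as a real normed space by restriction of scalars. -/
noncomputable def vint (μ : Measure G) (f : G → E) : E :=
  letI : NormedSpace ℝ E := NormedSpace.restrictScalars ℝ 𝕜 E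
  ∫ s, f s ∂μ

theorem vint_eq_integral [h : NormedSpace ℝ E] [IsScalarTower ℝ 𝕜 E] (μ : Measure G) (f : G → E) :
    vint 𝕜 μ f = ∫ s, f s ∂μ := by
  have e : NormedSpace.restrictScalars ℝ 𝕜 E = h := by
    have h2 : (NormedSpace.restrictScalars ℝ 𝕜 E).toModule = h.toModule := by
      refine Module.ext' _ _ fun r x => ?_
      exact algebraMap_smul 𝕜 r x
    cases h
    cases h2
    rfl
  rw [vint, e]

theorem vint_zero (μ : Measure G) : vint 𝕜 μ (fun _ => (0 : E)) = 0 :=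
  let _ : NormedSpace ℝ E := NormedSpace.restrictScalars ℝ 𝕜 E
  integral_zero G E

theorem norm_vint_le (μ : Measure G) (f : G → E) : ‖vint 𝕜 μ f‖ ≤ ∫ s, ‖f s‖ ∂μ :=
  let _ : NormedSpace ℝ E := NormedSpace.restrictScalars ℝ 𝕜 E
  norm_integral_le_integral_norm f

variable [TopologicalSpace G] [OpensMeasurableSpace G] {μ : Measure G}
  [IsFiniteMeasureOnCompacts μ]

theorem vint_add {f g : G → E} (hf : Continuous f) (hf' : HasCompactSupport f)
    (hg : Continuous g) (hg' : HasCompactSupport g) :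
    vint 𝕜 μ (fun s => f s + g s) = vint 𝕜 μ f + vint 𝕜 μ g :=
  let _ : NormedSpace ℝ E := NormedSpace.restrictScalars ℝ 𝕜 E
  integral_add (hf.integrable_of_hasCompactSupport hf') (hg.integrable_of_hasCompactSupport hg')

theorem map_vint [CompleteSpace E] [CompleteSpace F] (L : E →L[𝕜] F) {f : G → E}
    (hf : Continuous f) (hf' : HasCompactSupport f) :
    L (vint 𝕜 μ f) = vint 𝕜 μ (fun s => L (f s)) := by
  let _ : NormedSpace ℝ E := NormedSpace.restrictScalars ℝ 𝕜 E
  let _ : NormedSpace ℝ F := NormedSpace.restrictScalars ℝ 𝕜 F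
  exact (L.integral_comp_comm (hf.integrable_of_hasCompactSupport hf')).symm

theorem vint_swap {f : G → G → E} (hf : Continuous f.uncurry)
    (hf' : HasCompactSupport f.uncurry) :
    vint 𝕜 μ (fun s => vint 𝕜 μ (fun r => f s r)) =
      vint 𝕜 μ (fun r => vint 𝕜 μ (fun s => f s r)) :=
  let _ : NormedSpace ℝ E := NormedSpace.restrictScalars ℝ 𝕜 E
  integral_integral_swap_of_hasCompactSupport hf hf'

theorem continuousOn_vint {f : G → G → E} {k t : Set G} (hk : IsCompact k)
    (hf : Continuous f.uncurry) (hfs : ∀ p x, p ∈ t → x ∉ k → f p x = 0) :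
    ContinuousOn (fun p => vint 𝕜 μ (f p)) t :=
  let _ : NormedSpace ℝ E := NormedSpace.restrictScalars ℝ 𝕜 E
  continuousOn_integral_of_compact_support hk hf.continuousOn hfs

end Integral

theorem vint_mul_left (𝕜 : Type*) [RCLike 𝕜] {G : Type*} [Group G] [TopologicalSpace G]
    [IsTopologicalGroup G] [MeasurableSpace G] [BorelSpace G] {E : Type*} [NormedAddCommGroup E]
    [NormedSpace 𝕜 E] (μ : Measure G) [μ.IsMulLeftInvariant] (f : G → E) (g : G) :
    vint 𝕜 μ (fun s => f (g * s)) = vint 𝕜 μ f :=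
  let _ : NormedSpace ℝ E := NormedSpace.restrictScalars ℝ 𝕜 E
  integral_mul_left_eq_self f g

theorem exists_bound_on_compact {𝕜 : Type*} [RCLike 𝕜] {G : Type*} [TopologicalSpace G]
    {E : Type*} [NormedAddCommGroup E] [NormedSpace 𝕜 E] [CompleteSpace E]
    {φ : G → (E →L[𝕜] E)} (hφ : ∀ x, Continuous fun s => φ s x) {K : Set G} (hK : IsCompact K) :
    ∃ M : ℝ, 0 ≤ M ∧ ∀ s ∈ K, ‖φ s‖ ≤ M := by
  obtain ⟨M, hM⟩ := banach_steinhaus (g := fun s : K => φ s) (fun x => by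
    obtain ⟨C, hC⟩ := hK.exists_bound_of_continuousOn (hφ x).continuousOn
    exact ⟨C, fun s => hC s s.2⟩)
  exact ⟨max M 0, le_max_right _ _, fun s hs => (hM ⟨s, hs⟩).trans (le_max_left _ _)⟩

/-- A strongly continuous family of bounded operators on a Banach space, indexed by a locally
compact space, is jointly continuous. -/
theorem continuous_joint {𝕜 : Type*} [RCLike 𝕜] {G : Type*} [TopologicalSpace G]
    [LocallyCompactSpace G] {E : Type*} [NormedAddCommGroup E] [NormedSpace 𝕜 E] [CompleteSpace E]
    {φ : G → (E →L[𝕜] E)} (hφ : ∀ x, Continuous fun s => φ s x) :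
    Continuous fun p : G × E => φ p.1 p.2 := by
  rw [continuous_iff_continuousAt]
  rintro ⟨s, x⟩
  obtain ⟨K, hK, hKs⟩ := exists_compact_mem_nhds s
  obtain ⟨M, hM0, hM⟩ := exists_bound_on_compact hφ hK
  have h1 : Tendsto (fun p : G × E => φ p.1 x) (𝓝 (s, x)) (𝓝 (φ s x)) :=
    ((hφ x).comp continuous_fst).tendsto (s, x)
  have h2 : Tendsto (fun p : G × E => φ p.1 (p.2 - x)) (𝓝 (s, x)) (𝓝 0) := by
    have h3 : Tendsto (fun p : G × E => M * ‖p.2 - x‖) (𝓝 (s, x)) (𝓝 0) := by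
      have : Continuous fun p : G × E => M * ‖p.2 - x‖ := by fun_prop
      simpa using this.tendsto (s, x)
    refine squeeze_zero_norm' ?_ h3
    filter_upwards [continuous_fst.continuousAt.preimage_mem_nhds (x := (s, x)) hKs] with p hp
    exact ((φ p.1).le_opNorm _).trans (by gcongr; exact hM _ hp)
  have := h1.add h2
  simpa [ContinuousAt] using this

section Defs

variable {𝕜 : Type v} [RCLike 𝕜]
  {A : Type*} [NonUnitalNormedRing A] [NormedSpace 𝕜 A] [IsScalarTower 𝕜 A A]
  [SMulCommClass 𝕜 A A]
  {G : Type*} [Group G] [TopologicalSpace G]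

/-- A strongly continuous action `α` of the group `G` on the algebra `A` by bounded algebra
automorphisms. (As `α` is multiplicative with `α 1 = id`, every `α s` is invertible in `B(A)`.) -/
structure DynSys (𝕜 : Type*) [RCLike 𝕜] (A : Type*) [NonUnitalNormedRing A] [NormedSpace 𝕜 A]
    (G : Type*) [Group G] [TopologicalSpace G] where
  act : G →* (A →L[𝕜] A)
  act_mul : ∀ s a b, act s (a * b) = act s a * act s b
  continuous_act : ∀ a, Continuous fun s => act s a

/-- A covariant representation `(π, U)` of the system on the normed space `X`. (A multiplicative
map `U` with `U 1 = id` automatically has values in the invertible operators.) -/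
structure CovRep (α : DynSys 𝕜 A G) (X : Type*) [NormedAddCommGroup X] [NormedSpace 𝕜 X] where
  π : A →ₙₐ[𝕜] (X →L[𝕜] X)
  U : G →* (X →L[𝕜] X)
  covariant : ∀ a s, π (α.act s a) = U s * π a * U s⁻¹

/-- A continuous covariant representation: `π` is norm bounded, `U` is strongly continuous. -/
structure ContCovRep (α : DynSys 𝕜 A G) (X : Type*) [NormedAddCommGroup X] [NormedSpace 𝕜 X]
    extends CovRep α X where
  bounded : ∃ C : ℝ, ∀ a, ‖π a‖ ≤ C * ‖a‖
  continuous_U : ∀ x, Continuous fun s => U s x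

variable [IsTopologicalGroup G] [LocallyCompactSpace G] [T2Space G] [CompleteSpace A]
  [MeasurableSpace G] [BorelSpace G] (μ : Measure G) [μ.IsHaarMeasure]

theorem DynSys.continuous_joint (α : DynSys 𝕜 A G) :
    Continuous fun p : G × A => α.act p.1 p.2 :=
  CrossedProd.continuous_joint α.continuous_act

theorem DynSys.act_act (α : DynSys 𝕜 A G) (s t : G) (a : A) :
    α.act s (α.act t a) = α.act (s * t) a := by
  rw [map_mul]; rfl

section Convolution

variable (α : DynSys 𝕜 A G)

theorem continuous_convIntegrand (f g : C_c(G, A)) :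
    Continuous (Function.uncurry fun s r : G => f r * α.act r (g (r⁻¹ * s))) := by
  have h := α.continuous_joint.comp
    (f := fun p : G × G => (p.2, g (p.2⁻¹ * p.1))) (by fun_prop)
  exact (f.continuous.comp continuous_snd).mul h

theorem convIntegrand_eq_zero (f g : C_c(G, A)) {s r : G}
    (h : r ∉ tsupport f) : f r * α.act r (g (r⁻¹ * s)) = 0 := by
  rw [image_eq_zero_of_notMem_tsupport h, zero_mul]

theorem convIntegrand_eq_zero' (f g : C_c(G, A)) {s r : G}
    (h : s ∉ (fun p : G × G => p.1 * p.2) '' (tsupport f ×ˢ tsupport g)) :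
    f r * α.act r (g (r⁻¹ * s)) = 0 := by
  by_cases hr : r ∈ tsupport f
  · have : r⁻¹ * s ∉ tsupport g := fun h' => h ⟨(r, r⁻¹ * s), ⟨hr, h'⟩, by simp⟩
    rw [image_eq_zero_of_notMem_tsupport this, map_zero, mul_zero]
  · exact convIntegrand_eq_zero α f g hr

theorem isCompact_mulSupport (f g : C_c(G, A)) :
    IsCompact ((fun p : G × G => p.1 * p.2) '' (tsupport f ×ˢ tsupport g)) :=
  (f.hasCompactSupport.prod g.hasCompactSupport).image continuous_mul

/-- The twisted convolution product `(f * g)(s) = ∫ f(r) α_r(g(r⁻¹ s)) dr` on `C_c(G, A)`. -/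
noncomputable def conv (f g : C_c(G, A)) : C_c(G, A) where
  toFun s := vint 𝕜 μ fun r => f r * α.act r (g (r⁻¹ * s))
  continuous_toFun := by
    rw [← continuousOn_univ]
    exact continuousOn_vint 𝕜 f.hasCompactSupport (continuous_convIntegrand α f g)
      fun p x _ hx => convIntegrand_eq_zero α f g hx
  hasCompactSupport' := by
    refine HasCompactSupport.intro (isCompact_mulSupport f g) fun s hs => ?_
    simp only [convIntegrand_eq_zero' α f g hs]
    exact vint_zero 𝕜 μ

theorem conv_apply (f g : C_c(G, A)) (s : G) :
    conv μ α f g s = vint 𝕜 μ fun r => f r * α.act r (g (r⁻¹ * s)) := rfl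

theorem convIntegrand_slice (f g : C_c(G, A)) (s : G) :
    Continuous (fun r : G => f r * α.act r (g (r⁻¹ * s))) ∧
      HasCompactSupport (fun r : G => f r * α.act r (g (r⁻¹ * s))) :=
  ⟨(continuous_convIntegrand α f g).comp (by fun_prop : Continuous fun r : G => (s, r)),
    HasCompactSupport.intro f.hasCompactSupport fun _ hr => convIntegrand_eq_zero α f g hr⟩

theorem conv_add (f g h : C_c(G, A)) : conv μ α f (g + h) = conv μ α f g + conv μ α f h := by
  ext s
  simp only [conv_apply, CompactlySupportedContinuousMap.add_apply, map_add, mul_add]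
  have h1 := convIntegrand_slice α f g s
  have h2 := convIntegrand_slice α f h s
  exact vint_add 𝕜 h1.1 h1.2 h2.1 h2.2

theorem add_conv (f g h : C_c(G, A)) : conv μ α (f + g) h = conv μ α f h + conv μ α g h := by
  ext s
  simp only [conv_apply, CompactlySupportedContinuousMap.add_apply, add_mul]
  have h1 := convIntegrand_slice α f h s
  have h2 := convIntegrand_slice α g h s
  exact vint_add 𝕜 h1.1 h1.2 h2.1 h2.2

theorem smul_conv (c : 𝕜) (f g : C_c(G, A)) : conv μ α (c • f) g = c • conv μ α f g := by
  ext s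
  have h1 := convIntegrand_slice α f g s
  have := map_vint 𝕜 (μ := μ) (c • ContinuousLinearMap.id 𝕜 A) h1.1 h1.2
  simpa [conv_apply, smul_mul_assoc] using this.symm

theorem conv_smul (c : 𝕜) (f g : C_c(G, A)) : conv μ α f (c • g) = c • conv μ α f g := by
  ext s
  have h1 := convIntegrand_slice α f g s
  have := map_vint 𝕜 (μ := μ) (c • ContinuousLinearMap.id 𝕜 A) h1.1 h1.2
  simpa [conv_apply, mul_smul_comm] using this.symm

theorem zero_conv (f : C_c(G, A)) : conv μ α 0 f = 0 := by
  have := smul_conv μ α (0 : 𝕜) 0 f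
  rwa [zero_smul, zero_smul] at this

theorem conv_zero (f : C_c(G, A)) : conv μ α f 0 = 0 := by
  have := conv_smul μ α (0 : 𝕜) f 0
  rwa [zero_smul, zero_smul] at this

theorem conv_assoc (f g h : C_c(G, A)) :
    conv μ α (conv μ α f g) h = conv μ α f (conv μ α g h) := by
  ext s
  have e1 : ∀ t, conv μ α f g t * α.act t (h (t⁻¹ * s)) =
      vint 𝕜 μ fun r => f r * α.act r (g (r⁻¹ * t)) * α.act t (h (t⁻¹ * s)) := fun t => by
    have h1 := convIntegrand_slice α f g t
    exact map_vint 𝕜 (μ := μ)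
      ((ContinuousLinearMap.mul 𝕜 A).flip (α.act t (h (t⁻¹ * s)))) h1.1 h1.2
  have e2 : ∀ r, f r * α.act r (conv μ α g h (r⁻¹ * s)) =
      vint 𝕜 μ fun t => f r * α.act r (g (r⁻¹ * t)) * α.act t (h (t⁻¹ * s)) := fun r => by
    have h1 := convIntegrand_slice α g h (r⁻¹ * s)
    have := map_vint 𝕜 (μ := μ)
      ((ContinuousLinearMap.mul 𝕜 A (f r)).comp (α.act r)) h1.1 h1.2
    rw [← vint_mul_left 𝕜 μ _ r]
    refine this.trans ?_
    congr 1
    ext t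
    simp only [ContinuousLinearMap.comp_apply, ContinuousLinearMap.mul_apply', α.act_mul,
      α.act_act, mul_assoc, inv_mul_cancel_left, mul_inv_rev]
  rw [conv_apply, conv_apply]
  simp only [e1, e2]
  apply vint_swap
  · have c1 := continuous_convIntegrand α f g
    have c2 := α.continuous_joint.comp
      (f := fun p : G × G => (p.1, h (p.1⁻¹ * s))) (by fun_prop)
    exact c1.mul c2
  · refine HasCompactSupport.intro ((isCompact_mulSupport f g).prod f.hasCompactSupport) ?_
    rintro ⟨t, r⟩ hp
    simp only [Function.uncurry]
    rw [Set.mem_prod, not_and_or] at hp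
    rcases hp with hp | hp
    · rw [convIntegrand_eq_zero' α f g hp, zero_mul]
    · rw [convIntegrand_eq_zero α f g hp, zero_mul]

end Convolution

section IntegratedForm

variable {α : DynSys 𝕜 A G} {X : Type*} [NormedAddCommGroup X] [NormedSpace 𝕜 X] [CompleteSpace X]

theorem ContCovRep.continuous_joint (p : ContCovRep α X) :
    Continuous fun q : G × X => p.U q.1 q.2 :=
  CrossedProd.continuous_joint p.continuous_U

theorem ContCovRep.continuous_π (p : ContCovRep α X) : Continuous p.π := by
  obtain ⟨C, hC⟩ := p.bounded
  exact AddMonoidHomClass.continuous_of_bound p.π C hC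

theorem intIntegrand (p : ContCovRep α X) (f : C_c(G, A)) (x : X) :
    Continuous (fun s => p.π (f s) (p.U s x)) ∧
      HasCompactSupport (fun s => p.π (f s) (p.U s x)) := by
  refine ⟨(p.continuous_π.comp f.continuous).clm_apply (p.continuous_U x), ?_⟩
  refine HasCompactSupport.intro f.hasCompactSupport fun s hs => ?_
  simp [image_eq_zero_of_notMem_tsupport hs]

theorem norm_intForm_le (p : ContCovRep α X) (f : C_c(G, A)) {C M : ℝ} (hC0 : 0 ≤ C)
    (hC : ∀ a, ‖p.π a‖ ≤ C * ‖a‖) (hM : ∀ s ∈ tsupport f, ‖p.U s‖ ≤ M) (x : X) :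
    ‖vint 𝕜 μ fun s => p.π (f s) (p.U s x)‖ ≤ C * M * (∫ s, ‖f s‖ ∂μ) * ‖x‖ := by
  refine (norm_vint_le 𝕜 μ _).trans ?_
  rw [show C * M * (∫ s, ‖f s‖ ∂μ) * ‖x‖ = ∫ s, C * M * ‖x‖ * ‖f s‖ ∂μ by
    rw [integral_const_mul]; ring]
  have h1 := intIntegrand p f x
  refine integral_mono (h1.1.norm.integrable_of_hasCompactSupport h1.2.norm)
    ((f.continuous.norm.integrable_of_hasCompactSupport f.hasCompactSupport.norm).const_mul _)
    fun s => ?_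
  by_cases hs : s ∈ tsupport f
  · calc ‖p.π (f s) (p.U s x)‖ ≤ ‖p.π (f s)‖ * (‖p.U s‖ * ‖x‖) :=
          (p.π (f s)).le_opNorm_of_le ((p.U s).le_opNorm x)
      _ ≤ (C * ‖f s‖) * (M * ‖x‖) := by gcongr; exacts [hC _, hM s hs]
      _ = C * M * ‖x‖ * ‖f s‖ := by ring
  · simp [image_eq_zero_of_notMem_tsupport hs]

/-- The integrated form `π ⋊ U (f) = ∫ π(f(s)) U_s ds`, an operator defined pointwise on `X`. -/
noncomputable def intForm (p : ContCovRep α X) (f : C_c(G, A)) : X →L[𝕜] X :=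
  LinearMap.mkContinuousOfExistsBound
    { toFun := fun x => vint 𝕜 μ fun s => p.π (f s) (p.U s x)
      map_add' := fun x y => by
        have h1 := intIntegrand p f x
        have h2 := intIntegrand p f y
        simpa only [map_add] using vint_add 𝕜 (μ := μ) h1.1 h1.2 h2.1 h2.2
      map_smul' := fun c x => by
        have h1 := intIntegrand p f x
        have := map_vint 𝕜 (μ := μ) (c • ContinuousLinearMap.id 𝕜 X) h1.1 h1.2
        simpa using this.symm }
    (by
      obtain ⟨C, hC⟩ := p.bounded
      obtain ⟨M, hM0, hM⟩ := exists_bound_on_compact p.continuous_U f.hasCompactSupport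
      exact ⟨_, norm_intForm_le μ p f (le_max_right C 0)
        (fun a => (hC a).trans (by gcongr; exact le_max_left _ _)) hM⟩)

theorem intForm_apply (p : ContCovRep α X) (f : C_c(G, A)) (x : X) :
    intForm μ p f x = vint 𝕜 μ fun s => p.π (f s) (p.U s x) := rfl

theorem intForm_add (p : ContCovRep α X) (f g : C_c(G, A)) :
    intForm μ p (f + g) = intForm μ p f + intForm μ p g := by
  ext x
  have h1 := intIntegrand p f x
  have h2 := intIntegrand p g x
  simpa [intForm_apply] using vint_add 𝕜 (μ := μ) h1.1 h1.2 h2.1 h2.2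

theorem intForm_smul (p : ContCovRep α X) (c : 𝕜) (f : C_c(G, A)) :
    intForm μ p (c • f) = c • intForm μ p f := by
  ext x
  have h1 := intIntegrand p f x
  have := map_vint 𝕜 (μ := μ) (c • ContinuousLinearMap.id 𝕜 X) h1.1 h1.2
  simpa [intForm_apply] using this.symm

theorem intForm_conv (p : ContCovRep α X) (f g : C_c(G, A)) :
    intForm μ p (conv μ α f g) = intForm μ p f * intForm μ p g := by
  ext x
  let πL : A →L[𝕜] (X →L[𝕜] X) := ⟨(p.π : A →ₗ[𝕜] (X →L[𝕜] X)), p.continuous_π⟩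
  have e1 : ∀ s, p.π (conv μ α f g s) (p.U s x) =
      vint 𝕜 μ fun r => p.π (f r * α.act r (g (r⁻¹ * s))) (p.U s x) := fun s => by
    have h1 := convIntegrand_slice α f g s
    exact map_vint 𝕜 (μ := μ)
      ((ContinuousLinearMap.apply 𝕜 X (p.U s x)).comp πL) h1.1 h1.2
  have e2 : ∀ r, p.π (f r) (p.U r (intForm μ p g x)) =
      vint 𝕜 μ fun s => p.π (f r * α.act r (g (r⁻¹ * s))) (p.U s x) := fun r => by
    have h1 := intIntegrand p g x
    have := map_vint 𝕜 (μ := μ) ((p.π (f r)).comp (p.U r)) h1.1 h1.2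
    rw [← vint_mul_left 𝕜 μ _ r]
    refine this.trans ?_
    congr 1
    ext t
    have h2 : p.U r⁻¹ (p.U r (p.U t x)) = p.U t x := by
      change (p.U r⁻¹ * p.U r) (p.U t x) = _
      rw [← map_mul]; simp
    simp [p.covariant, h2]
  change intForm μ p (conv μ α f g) x = intForm μ p f (intForm μ p g x)
  rw [intForm_apply, intForm_apply μ p f]
  simp only [e1, e2]
  apply vint_swap
  · exact (p.continuous_π.comp (continuous_convIntegrand α f g)).clm_apply
      ((p.continuous_U x).comp continuous_fst)
  · refine HasCompactSupport.intro ((isCompact_mulSupport f g).prod f.hasCompactSupport) ?_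
    rintro ⟨t, r⟩ hp
    simp only [Function.uncurry]
    rw [Set.mem_prod, not_and_or] at hp
    rcases hp with hp | hp
    · rw [convIntegrand_eq_zero' α f g hp, map_zero]; rfl
    · rw [convIntegrand_eq_zero α f g hp, map_zero]; rfl

end IntegratedForm

section Involution

variable (α : DynSys 𝕜 A G)

/-- The modular function, normalised by `Δ(r) ∫ f(s r) ds = ∫ f(s) ds`. -/
noncomputable def modular (r : G) : ℝ := (Measure.modularCharacterFun r⁻¹ : ℝ)

theorem integral_mul_right_eq {f : G → ℝ} (hf : Continuous f) (hf' : HasCompactSupport f) (r : G) :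
    ∫ s, f (s * r) ∂μ = modular r⁻¹ * ∫ s, f s ∂μ := by
  have h1 := Measure.integral_isMulLeftInvariant_eq_smul_of_hasCompactSupport
    (Measure.map (· * r) μ) μ hf hf'
  rw [← Measure.modularCharacterFun_eq_haarScalarFactor, integral_smul_nnreal_measure,
    integral_map (by fun_prop) hf.aestronglyMeasurable] at h1
  rw [h1, modular, inv_inv]
  rfl

theorem modular_mul_integral {f : G → ℝ} (hf : Continuous f) (hf' : HasCompactSupport f) (r : G) :
    modular r * ∫ s, f (s * r) ∂μ = ∫ s, f s ∂μ := by
  have h1 := Measure.modularCharacterFun_map_mul r⁻¹ r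
  rw [inv_mul_cancel, Measure.modularCharacterFun_map_one] at h1
  rw [integral_mul_right_eq μ hf hf', modular, modular, inv_inv, ← mul_assoc, ← NNReal.coe_mul,
    ← h1, NNReal.coe_one, one_mul]

theorem continuous_modular : Continuous (modular : G → ℝ) := by
  let ν : Measure G := Measure.haar
  obtain ⟨⟨g, g_cont⟩, g_comp, g_nonneg, g_one⟩ :
    ∃ g : C(G, ℝ), HasCompactSupport g ∧ 0 ≤ g ∧ g 1 ≠ 0 := exists_continuous_nonneg_pos 1
  have hpos : 0 < ∫ x, g x ∂ν :=
    g_cont.integral_pos_of_hasCompactSupport_nonneg_nonzero g_comp g_nonneg g_one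
  have h1 : ∀ x, ∫ y, g (y⁻¹ * x) ∂ν.inv = modular x⁻¹ * ∫ s, g s ∂ν := fun x => by
    rw [← integral_mul_right_eq ν g_cont g_comp, Measure.inv, integral_map]
    · simp
    · fun_prop
    · exact (by fun_prop : Continuous fun y => g (y⁻¹ * x)).aestronglyMeasurable
  have h2 : Continuous fun x : G => modular x⁻¹ := by
    have h3 := (continuous_integral_apply_inv_mul (μ := ν.inv) g_cont g_comp).div_const
      (∫ s, g s ∂ν)
    refine h3.congr fun x => ?_
    rw [h1, mul_div_cancel_right₀ _ hpos.ne']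
  refine (h2.comp continuous_inv).congr fun x => ?_
  simp

theorem integral_modular_inv {f : G → ℝ} (hf : Continuous f) (hf' : HasCompactSupport f) :
    ∫ s, modular s⁻¹ * f s⁻¹ ∂μ = ∫ s, f s ∂μ := by
  obtain ⟨⟨g, g_cont⟩, g_comp, g_nonneg, g_one⟩ :
    ∃ g : C(G, ℝ), HasCompactSupport g ∧ 0 ≤ g ∧ g 1 ≠ 0 := exists_continuous_nonneg_pos 1
  have hpos : 0 < ∫ x, g x ∂μ :=
    g_cont.integral_pos_of_hasCompactSupport_nonneg_nonzero g_comp g_nonneg g_one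
  have h1 : ∀ x, ∫ y, g (y⁻¹ * x) ∂μ.inv = modular x⁻¹ * ∫ s, g s ∂μ := fun x => by
    rw [← integral_mul_right_eq μ g_cont g_comp, Measure.inv, integral_map]
    · simp
    · fun_prop
    · exact (by fun_prop : Continuous fun y => g (y⁻¹ * x)).aestronglyMeasurable
  have hm : ∀ x : G, modular x⁻¹ * modular x = 1 := fun x => by
    have h1 := Measure.modularCharacterFun_map_mul x x⁻¹
    rw [mul_inv_cancel, Measure.modularCharacterFun_map_one] at h1
    rw [modular, modular, inv_inv, ← NNReal.coe_mul, ← h1, NNReal.coe_one]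
  have h2 := Measure.integral_isMulLeftInvariant_isMulRightInvariant_combo (μ := μ) (ν := μ.inv)
    hf hf' g_cont g_comp g_nonneg g_one
  simp only [h1] at h2
  rw [h2, Measure.inv, integral_map, ← integral_mul_const]
  · congr 1
    ext s
    have h3 := hm s
    have h4 : modular s ≠ 0 := right_ne_zero_of_mul (by rw [h3]; exact one_ne_zero)
    rw [inv_inv]
    field_simp
    rw [mul_right_comm, h3, one_mul]
  · fun_prop
  · refine Continuous.aestronglyMeasurable (hf.mul (Continuous.inv₀ ?_ ?_))
    · exact (continuous_modular.comp continuous_inv).mul continuous_const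
    · exact fun x => mul_ne_zero (left_ne_zero_of_mul (by rw [hm]; exact one_ne_zero)) hpos.ne'

theorem vint_modular_inv {f : G → 𝕜} (hf : Continuous f) (hf' : HasCompactSupport f) :
    vint 𝕜 μ (fun s => (modular s⁻¹ : 𝕜) * f s⁻¹) = vint 𝕜 μ f := by
  have key : ∀ L : 𝕜 →L[ℝ] ℝ, L (vint 𝕜 μ (fun s => (modular s⁻¹ : 𝕜) * f s⁻¹))
      = L (vint 𝕜 μ f) := fun L => by
    have hc : Continuous fun s : G => (modular s⁻¹ : 𝕜) * f s⁻¹ :=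
      (RCLike.continuous_ofReal.comp (continuous_modular.comp continuous_inv)).mul
        (hf.comp continuous_inv)
    have hc' : HasCompactSupport fun s : G => (modular s⁻¹ : 𝕜) * f s⁻¹ :=
      (hf'.comp_homeomorph (Homeomorph.inv G)).mul_left
    have e1 := L.integral_comp_comm (hc.integrable_of_hasCompactSupport (μ := μ) hc')
    have e2 := L.integral_comp_comm (hf.integrable_of_hasCompactSupport (μ := μ) hf')
    have e3 := integral_modular_inv μ (L.continuous.comp hf) (hf'.comp_left (map_zero L))
    rw [vint_eq_integral, vint_eq_integral]
    refine e1.symm.trans (Eq.trans ?_ e2)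
    rw [← Function.comp_def L f, ← e3]
    congr 1
    ext s
    rw [← RCLike.real_smul_eq_coe_mul, map_smul]
    rfl
  exact RCLike.ext (key RCLike.reCLM) (key RCLike.imCLM)

variable [StarRing A] [StarModule 𝕜 A] [ContinuousStar A]

/-- The involution `f^*(s) = Δ(s⁻¹) α_s(f(s⁻¹)^*)` on `C_c(G, A)`. -/
noncomputable def ccStar (f : C_c(G, A)) : C_c(G, A) where
  toFun s := (modular s⁻¹ : 𝕜) • α.act s (star (f s⁻¹))
  continuous_toFun := by
    refine (RCLike.continuous_ofReal.comp (continuous_modular.comp continuous_inv)).smul ?_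
    exact α.continuous_joint.comp (f := fun s : G => (s, star (f s⁻¹))) (by fun_prop)
  hasCompactSupport' := by
    have h := f.hasCompactSupport.comp_homeomorph (Homeomorph.inv G)
    refine HasCompactSupport.intro h fun s hs => ?_
    have : f s⁻¹ = 0 := image_eq_zero_of_notMem_tsupport (f := f ∘ Homeomorph.inv G) hs
    simp [this]

theorem ccStar_sub (f g : C_c(G, A)) : ccStar α (f - g) = ccStar α f - ccStar α g := by
  ext s
  simp [ccStar, smul_sub]

end Involution

section Involutive

variable [StarRing A] {α : DynSys 𝕜 A G} {X : Type*} [NormedAddCommGroup X] [i : NormedSpace 𝕜 X]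

/-- The system is involutive: every `α s` is a `*`-automorphism of `A`. -/
def DynSys.IsInvolutive (α : DynSys 𝕜 A G) : Prop :=
  ∀ s a, α.act s (star a) = star (α.act s a)

/-- `(π, U)` is an involutive covariant representation: the space `X` is a Hilbert space (its norm
comes from a, necessarily unique, inner product), `π(a^*) = π(a)^*`, and each `U s` is unitary. -/
def CovRep.IsInvolutive (p : CovRep α X) : Prop :=
  ∃ h : InnerProductSpace 𝕜 X, h.toNormedSpace = i ∧
    (∀ a x y, h.inner (p.π (star a) x) y = h.inner x (p.π a y)) ∧
    ∀ s x y, h.inner (p.U s x) (p.U s y) = h.inner x y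

end Involutive

/-- A bundled Banach space over `𝕜`. -/
structure BanachSp (𝕜 : Type v) [RCLike 𝕜] where
  carrier : Type w
  [group : NormedAddCommGroup carrier]
  [space : NormedSpace 𝕜 carrier]
  [complete : CompleteSpace carrier]

instance : CoeSort (BanachSp 𝕜) (Type _) := ⟨BanachSp.carrier⟩

attribute [instance] BanachSp.group BanachSp.space BanachSp.complete

/-- A non-empty uniformly bounded class `R` of continuous covariant representations on Banach
spaces. -/
structure UBClass (α : DynSys 𝕜 A G) where
  carrier : Set (Σ X : BanachSp.{v, w} 𝕜, ContCovRep α X)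
  nonempty : carrier.Nonempty
  bounded : ∃ C : ℝ, 0 ≤ C ∧ ∃ ν : G → ℝ, (∀ r, 0 ≤ ν r) ∧
    (∀ K : Set G, IsCompact K → BddAbove (ν '' K)) ∧
    ∀ p ∈ carrier, (∀ a, ‖p.2.π a‖ ≤ C * ‖a‖) ∧ ∀ r, ‖p.2.U r‖ ≤ ν r

section Seminorm

variable {α : DynSys 𝕜 A G} (R : UBClass α)

/-- The seminorm `σ^R(f) = sup_{(π, U) ∈ R} ‖π ⋊ U (f)‖` on `C_c(G, A)`. -/
noncomputable def sigma (f : C_c(G, A)) : ℝ := ⨆ p : R.carrier, ‖intForm μ p.1.2 f‖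

theorem sigma_bddAbove (f : C_c(G, A)) :
    BddAbove (Set.range fun p : R.carrier => ‖intForm μ p.1.2 f‖) := by
  obtain ⟨C, hC0, ν, hν0, hν, h⟩ := R.bounded
  obtain ⟨M, hM⟩ := hν _ f.hasCompactSupport
  refine ⟨C * max M 0 * ∫ s, ‖f s‖ ∂μ, ?_⟩
  rintro _ ⟨p, rfl⟩
  refine ContinuousLinearMap.opNorm_le_bound _ (by positivity) fun x => ?_
  exact norm_intForm_le μ p.1.2 f hC0 (h p.1 p.2).1
    (fun s hs => ((h p.1 p.2).2 s).trans ((hM ⟨s, hs, rfl⟩).trans (le_max_left _ _))) x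

theorem norm_intForm_le_sigma (f : C_c(G, A)) {p : Σ X : BanachSp.{v, w} 𝕜, ContCovRep α X}
    (hp : p ∈ R.carrier) : ‖intForm μ p.2 f‖ ≤ sigma μ R f :=
  le_ciSup (sigma_bddAbove μ R f) ⟨p, hp⟩

theorem sigma_nonneg (f : C_c(G, A)) : 0 ≤ sigma μ R f :=
  Real.iSup_nonneg fun _ => norm_nonneg _

theorem sigma_le {f : C_c(G, A)} {c : ℝ} (h : ∀ p ∈ R.carrier, ‖intForm μ p.2 f‖ ≤ c) :
    sigma μ R f ≤ c :=
  have : Nonempty R.carrier := R.nonempty.to_subtype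
  ciSup_le fun p => h p.1 p.2

theorem sigma_add_le (f g : C_c(G, A)) : sigma μ R (f + g) ≤ sigma μ R f + sigma μ R g := by
  refine sigma_le μ R fun p hp => ?_
  rw [intForm_add]
  exact (norm_add_le _ _).trans
    (add_le_add (norm_intForm_le_sigma μ R f hp) (norm_intForm_le_sigma μ R g hp))

theorem sigma_smul_le (c : 𝕜) (f : C_c(G, A)) : sigma μ R (c • f) ≤ ‖c‖ * sigma μ R f := by
  refine sigma_le μ R fun p hp => ?_
  rw [intForm_smul, norm_smul]
  gcongr
  exact norm_intForm_le_sigma μ R f hp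

theorem sigma_zero : sigma μ R 0 = 0 := by
  have := sigma_smul_le μ R (0 : 𝕜) 0
  rw [zero_smul, norm_zero, zero_mul] at this
  exact le_antisymm this (sigma_nonneg μ R 0)

theorem sigma_neg (f : C_c(G, A)) : sigma μ R (-f) = sigma μ R f := by
  have h : ∀ g : C_c(G, A), sigma μ R (-g) ≤ sigma μ R g := fun g => by
    have := sigma_smul_le μ R (-1 : 𝕜) g
    rwa [neg_one_smul, norm_neg, norm_one, one_mul] at this
  refine le_antisymm (h f) ?_
  have := h (-f)
  rwa [neg_neg] at this

theorem sigma_conv_le (f g : C_c(G, A)) :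
    sigma μ R (conv μ α f g) ≤ sigma μ R f * sigma μ R g := by
  refine sigma_le μ R fun p hp => ?_
  rw [intForm_conv]
  exact (norm_mul_le _ _).trans (mul_le_mul (norm_intForm_le_sigma μ R f hp)
    (norm_intForm_le_sigma μ R g hp) (norm_nonneg _) (sigma_nonneg μ R f))

/-- The algebra `C_c(G, A)` with the twisted convolution product and the seminorm `σ^R`. -/
def CcAlg (_μ : Measure G) (_R : UBClass α) := C_c(G, A)

instance : AddCommGroup (CcAlg μ R) := inferInstanceAs (AddCommGroup C_c(G, A))

instance : Module 𝕜 (CcAlg μ R) := inferInstanceAs (Module 𝕜 C_c(G, A))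

noncomputable instance : NonUnitalRing (CcAlg μ R) :=
  { (inferInstance : AddCommGroup (CcAlg μ R)) with
    mul := conv μ α
    left_distrib := conv_add μ α
    right_distrib := add_conv μ α
    zero_mul := zero_conv μ α
    mul_zero := conv_zero μ α
    mul_assoc := conv_assoc μ α }

instance : IsScalarTower 𝕜 (CcAlg μ R) (CcAlg μ R) := ⟨fun c f g => smul_conv μ α c f g⟩

instance : SMulCommClass 𝕜 (CcAlg μ R) (CcAlg μ R) := ⟨fun c f g => (conv_smul μ α c f g).symm⟩

noncomputable instance : SeminormedAddCommGroup (CcAlg μ R) :=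
  AddGroupSeminorm.toSeminormedAddCommGroup
    { toFun := sigma μ R
      map_zero' := sigma_zero μ R
      add_le' := sigma_add_le μ R
      neg' := sigma_neg μ R }

theorem CcAlg.norm_def (f : CcAlg μ R) : ‖f‖ = sigma μ R f := rfl

noncomputable instance : NonUnitalSeminormedRing (CcAlg μ R) :=
  { (inferInstance : NonUnitalRing (CcAlg μ R)),
    (inferInstance : SeminormedAddCommGroup (CcAlg μ R)) with
    norm_mul_le := sigma_conv_le μ R }

noncomputable instance : NormedSpace 𝕜 (CcAlg μ R) where
  norm_smul_le := sigma_smul_le μ R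

end Seminorm

section CrossedProduct

open UniformSpace

variable {α : DynSys 𝕜 A G} (R : UBClass α)

/-- The crossed product `(A ⋊_α G)^R`: the (Hausdorff) completion of `C_c(G, A)` for `σ^R`. -/
def CrossedProduct := Completion (CcAlg μ R)

noncomputable instance : NormedAddCommGroup (CrossedProduct μ R) :=
  inferInstanceAs (NormedAddCommGroup (Completion (CcAlg μ R)))

noncomputable instance : NormedSpace 𝕜 (CrossedProduct μ R) :=
  inferInstanceAs (NormedSpace 𝕜 (Completion (CcAlg μ R)))

instance : CompleteSpace (CrossedProduct μ R) :=
  inferInstanceAs (CompleteSpace (Completion (CcAlg μ R)))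

/-- The canonical map `q^R : C_c(G, A) → (A ⋊_α G)^R`. -/
noncomputable def quot : CcAlg μ R →L[𝕜] CrossedProduct μ R :=
  Completion.toComplL (𝕜 := 𝕜) (E := CcAlg μ R)

theorem norm_quot (f : CcAlg μ R) : ‖quot μ R f‖ = sigma μ R f :=
  Completion.norm_coe (E := CcAlg μ R) f

theorem isDenseInducing_quot : IsDenseInducing (quot μ R) :=
  Completion.isDenseInducing_coe (α := CcAlg μ R)

theorem denseRange_quot : DenseRange (quot μ R) := (isDenseInducing_quot μ R).dense

/-- Multiplication on the crossed product: the continuous extension of twisted convolution. -/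
noncomputable instance : Mul (CrossedProduct μ R) :=
  ⟨fun x y => ((isDenseInducing_quot μ R).prodMap (isDenseInducing_quot μ R)).extend
    (fun p : CcAlg μ R × CcAlg μ R => quot μ R (p.1 * p.2)) (x, y)⟩

theorem quot_mul (f g : CcAlg μ R) : quot μ R (f * g) = quot μ R f * quot μ R g :=
  (((isDenseInducing_quot μ R).prodMap (isDenseInducing_quot μ R)).extend_eq
    (f := fun p : CcAlg μ R × CcAlg μ R => quot μ R (p.1 * p.2))
    ((quot μ R).continuous.comp continuous_mul) (f, g)).symm

instance : ContinuousMul (CrossedProduct μ R) where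
  continuous_mul := by
    let q : CcAlg μ R →+ CrossedProduct μ R := (quot μ R : CcAlg μ R →+ CrossedProduct μ R)
    let m := (AddMonoidHom.mul : CcAlg μ R →+ CcAlg μ R →+ CcAlg μ R).compr₂ q
    have h : Continuous fun p : CcAlg μ R × CcAlg μ R => m p.1 p.2 :=
      (quot μ R).continuous.comp continuous_mul
    have di : IsDenseInducing q := isDenseInducing_quot μ R
    exact di.extend_Z_bilin di h

noncomputable instance : NonUnitalRing (CrossedProduct μ R) :=
  { (inferInstance : AddCommGroup (CrossedProduct μ R)),
    (inferInstance : Mul (CrossedProduct μ R)) with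
    zero_mul := fun a => (denseRange_quot μ R).induction_on a
      (isClosed_eq (by fun_prop) (by fun_prop))
      fun f => by rw [← map_zero (quot μ R), ← quot_mul, zero_mul]
    mul_zero := fun a => (denseRange_quot μ R).induction_on a
      (isClosed_eq (by fun_prop) (by fun_prop))
      fun f => by rw [← map_zero (quot μ R), ← quot_mul, mul_zero]
    mul_assoc := fun a b c => (denseRange_quot μ R).induction_on₃
      (isClosed_eq (by fun_prop) (by fun_prop))
      (fun f g h => by simp only [← quot_mul, mul_assoc]) a b c
    left_distrib := fun a b c => (denseRange_quot μ R).induction_on₃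
      (isClosed_eq (by fun_prop) (by fun_prop))
      (fun f g h => by simp only [← quot_mul, ← map_add, mul_add]) a b c
    right_distrib := fun a b c => (denseRange_quot μ R).induction_on₃
      (isClosed_eq (by fun_prop) (by fun_prop))
      (fun f g h => by simp only [← quot_mul, ← map_add, add_mul]) a b c }

noncomputable instance : NonUnitalNormedRing (CrossedProduct μ R) :=
  { (inferInstance : NonUnitalRing (CrossedProduct μ R)),
    (inferInstance : NormedAddCommGroup (CrossedProduct μ R)) with
    norm_mul_le := fun a b => (denseRange_quot μ R).induction_on₂
      (isClosed_le (by fun_prop) (by fun_prop))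
      (fun f g => by
        rw [← quot_mul, norm_quot, norm_quot, norm_quot]; exact sigma_conv_le μ R f g) a b }

theorem cp_smul_mul (c : 𝕜) (a b : CrossedProduct μ R) : c • a * b = c • (a * b) :=
  (denseRange_quot μ R).induction_on₂ (p := fun a b => c • a * b = c • (a * b))
    (isClosed_eq ((continuous_fst.const_smul c).mul continuous_snd)
      ((continuous_fst.mul continuous_snd).const_smul c))
    (fun f g => by rw [← map_smul, ← quot_mul, ← quot_mul, ← map_smul, smul_mul_assoc]) a b

theorem cp_mul_smul (c : 𝕜) (a b : CrossedProduct μ R) : a * c • b = c • (a * b) :=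
  (denseRange_quot μ R).induction_on₂ (p := fun a b => a * c • b = c • (a * b))
    (isClosed_eq (continuous_fst.mul (continuous_snd.const_smul c))
      ((continuous_fst.mul continuous_snd).const_smul c))
    (fun f g => by rw [← map_smul, ← quot_mul, ← quot_mul, ← map_smul, mul_smul_comm]) a b

instance : IsScalarTower 𝕜 (CrossedProduct μ R) (CrossedProduct μ R) := ⟨cp_smul_mul μ R⟩

instance : SMulCommClass 𝕜 (CrossedProduct μ R) (CrossedProduct μ R) :=
  ⟨fun c a b => (cp_mul_smul μ R c a b).symm⟩

section IntRep

variable {R} {X : Type*} [NormedAddCommGroup X] [NormedSpace 𝕜 X] [CompleteSpace X]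

variable (R) in
/-- `(π, U)` is `R`-continuous: its integrated form is bounded with respect to `σ^R`. -/
def IsRCont (p : ContCovRep α X) : Prop :=
  ∃ C : ℝ, ∀ f : C_c(G, A), ‖intForm μ p f‖ ≤ C * sigma μ R f

theorem isRCont_of_mem {p : Σ X : BanachSp.{v, w} 𝕜, ContCovRep α X} (hp : p ∈ R.carrier) :
    IsRCont μ R p.2 :=
  ⟨1, fun f => by rw [one_mul]; exact norm_intForm_le_sigma μ R f hp⟩

/-- The integrated form of an `R`-continuous representation as a bounded operator on
`(C_c(G, A), σ^R)`. -/
noncomputable def intFormL {p : ContCovRep α X} (hp : IsRCont μ R p) :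
    CcAlg μ R →L[𝕜] (X →L[𝕜] X) :=
  LinearMap.mkContinuousOfExistsBound
    { toFun := fun f => intForm μ p f
      map_add' := intForm_add μ p
      map_smul' := intForm_smul μ p } hp

theorem isUniformInducing_quot : IsUniformInducing (quot μ R) :=
  Completion.isUniformInducing_coe (CcAlg μ R)

/-- The continuous extension of the integrated form to the crossed product. -/
noncomputable def intRepL {p : ContCovRep α X} (hp : IsRCont μ R p) :
    CrossedProduct μ R →L[𝕜] (X →L[𝕜] X) :=
  (intFormL μ hp).extend (quot μ R)

theorem intRepL_quot {p : ContCovRep α X} (hp : IsRCont μ R p) (f : CcAlg μ R) :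
    intRepL μ hp (quot μ R f) = intForm μ p f :=
  ContinuousLinearMap.extend_eq (intFormL μ hp) (denseRange_quot μ R) (isUniformInducing_quot μ) f

theorem intRepL_mul {p : ContCovRep α X} (hp : IsRCont μ R p) (a b : CrossedProduct μ R) :
    intRepL μ hp (a * b) = intRepL μ hp a * intRepL μ hp b :=
  (denseRange_quot μ R).induction_on₂
    (p := fun a b => intRepL μ hp (a * b) = intRepL μ hp a * intRepL μ hp b)
    (isClosed_eq ((intRepL μ hp).continuous.comp continuous_mul)
      (((intRepL μ hp).continuous.comp continuous_fst).mul
        ((intRepL μ hp).continuous.comp continuous_snd)))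
    (fun f g => by
      rw [← quot_mul, intRepL_quot, intRepL_quot, intRepL_quot]
      exact intForm_conv μ p f g) a b

/-- The representation `(π ⋊ U)^R` of the crossed product, determined by
`(π ⋊ U)^R (q^R f) = π ⋊ U (f)` and continuity. -/
noncomputable def intRep {p : ContCovRep α X} (hp : IsRCont μ R p) :
    CrossedProduct μ R →ₙₐ[𝕜] (X →L[𝕜] X) where
  toFun := intRepL μ hp
  map_smul' := map_smul (intRepL μ hp)
  map_zero' := map_zero (intRepL μ hp)
  map_add' := map_add (intRepL μ hp)
  map_mul' := intRepL_mul μ hp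

theorem continuous_intRep {p : ContCovRep α X} (hp : IsRCont μ R p) :
    Continuous (intRep μ hp) := (intRepL μ hp).continuous

theorem intRep_quot {p : ContCovRep α X} (hp : IsRCont μ R p) (f : CcAlg μ R) :
    intRep μ hp (quot μ R f) = intForm μ p f := intRepL_quot μ hp f

end IntRep

section Star

variable [StarRing A] [StarModule 𝕜 A] [ContinuousStar A]

/-- The involution on the crossed product: the continuous extension of the involution of
`C_c(G, A)`. (If the class `R` is involutive, then the latter is bounded with respect to
`σ^R`, see below, so that the extension exists.) -/
noncomputable def cpStar : CrossedProduct μ R → CrossedProduct μ R :=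
  Completion.map (α := CcAlg μ R) (β := CcAlg μ R) (ccStar α)

theorem inner_ccStar {α : DynSys 𝕜 A G} {X : Type*} [NormedAddCommGroup X]
    [i : NormedSpace 𝕜 X] [CompleteSpace X] (p : ContCovRep α X) (h : InnerProductSpace 𝕜 X)
    (hi : h.toNormedSpace = i)
    (hπ : ∀ a x y, h.inner (p.π (star a) x) y = h.inner x (p.π a y))
    (hU : ∀ s x y, h.inner (p.U s x) (p.U s y) = h.inner x y) (f : C_c(G, A)) (x y : X) :
    h.inner (intForm μ p (ccStar α f) x) y = h.inner x (intForm μ p f y) := by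
  subst hi
  have e1 := map_vint 𝕜 (μ := μ) (innerSL 𝕜 y) (intIntegrand p (ccStar α f) x).1
    (intIntegrand p (ccStar α f) x).2
  have e2 := map_vint 𝕜 (μ := μ) (innerSL 𝕜 x) (intIntegrand p f y).1 (intIntegrand p f y).2
  have hc : Continuous fun s => innerSL 𝕜 x (p.π (f s) (p.U s y)) :=
    (innerSL 𝕜 x).continuous.comp (intIntegrand p f y).1
  have hc' : HasCompactSupport fun s => innerSL 𝕜 x (p.π (f s) (p.U s y)) :=
    (intIntegrand p f y).2.comp_left (map_zero (innerSL 𝕜 x))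
  have e3 := vint_modular_inv μ hc hc'
  have hUU : ∀ s z, p.U s (p.U s⁻¹ z) = z := fun s z => by
    change (p.U s * p.U s⁻¹) z = z
    rw [← map_mul]; simp
  have key : ∀ s, inner 𝕜 (p.π (ccStar α f s) (p.U s x)) y =
      (modular s⁻¹ : 𝕜) * inner 𝕜 x (p.π (f s⁻¹) (p.U s⁻¹ y)) := fun s => by
    have h1 : p.π (ccStar α f s) (p.U s x) =
        (modular s⁻¹ : 𝕜) • p.U s (p.π (star (f s⁻¹)) x) := by
      change p.π ((modular s⁻¹ : 𝕜) • α.act s (star (f s⁻¹))) (p.U s x) = _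
      have h2 : p.U s⁻¹ (p.U s x) = x := by simpa using hUU s⁻¹ x
      simp [p.covariant, h2]
    rw [h1, inner_smul_left, RCLike.conj_ofReal]
    congr 1
    have h2 := hU s (p.π (star (f s⁻¹)) x) (p.U s⁻¹ y)
    rw [hUU] at h2
    exact h2.trans (hπ _ _ _)
  have hint : inner 𝕜 y (intForm μ p (ccStar α f) x) =
      vint 𝕜 μ fun s => inner 𝕜 y (p.π (ccStar α f s) (p.U s x)) := e1
  change inner 𝕜 (intForm μ p (ccStar α f) x) y = inner 𝕜 x (intForm μ p f y)
  rw [← inner_conj_symm, hint, vint_eq_integral, ← integral_conj]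
  simp only [inner_conj_symm, key]
  rw [← vint_eq_integral 𝕜]
  exact e3.trans e2.symm

/-- `R` is involutive: every `(π, U)` in `R` is involutive. -/
def UBClass.IsInvolutive (R : UBClass α) : Prop := ∀ p ∈ R.carrier, p.2.toCovRep.IsInvolutive

theorem sigma_ccStar_le (hR : R.IsInvolutive) (f : C_c(G, A)) :
    sigma μ R (ccStar α f) ≤ sigma μ R f := by
  refine sigma_le μ R fun p hp => ?_
  obtain ⟨h, hi, hπ, hU⟩ := hR p hp
  refine (ContinuousLinearMap.opNorm_le_bound _ (norm_nonneg _) fun x => ?_).trans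
    (norm_intForm_le_sigma μ R f hp)
  have h1 := inner_ccStar μ p.2 h hi hπ hU f x (intForm μ p.2 (ccStar α f) x)
  set z := intForm μ p.2 (ccStar α f) x with hz
  have h2 : ‖z‖ * ‖z‖ ≤ ‖x‖ * (‖intForm μ p.2 f‖ * ‖z‖) := by
    have h3 : ‖h.inner z z‖ = ‖z‖ * ‖z‖ := by
      have := inner_self_eq_norm_mul_norm (𝕜 := 𝕜) z
      rw [← this]
      exact (congrArg norm (inner_self_ofReal_re (𝕜 := 𝕜) z)).symm.trans
        (by rw [RCLike.norm_ofReal, abs_of_nonneg inner_self_nonneg])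
    rw [← h3, h1]
    refine (norm_inner_le_norm (𝕜 := 𝕜) x _).trans ?_
    gcongr
    exact (intForm μ p.2 f).le_opNorm z
  rcases (norm_nonneg z).eq_or_lt with h0 | h0
  · rw [← h0]; positivity
  · refine le_of_mul_le_mul_right ?_ h0
    linarith

theorem cpStar_quot (hR : R.IsInvolutive) (f : C_c(G, A)) :
    cpStar μ R (quot μ R f) = quot μ R (ccStar α f) := by
  have h : LipschitzWith (α := CcAlg μ R) (β := CcAlg μ R) 1 (ccStar α) := by
    refine LipschitzWith.of_dist_le_mul fun a b => ?_
    have h1 := sigma_ccStar_le μ R hR (a - b)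
    have h2 : dist a b = sigma μ R (a - b) := dist_eq_norm a b
    rw [NNReal.coe_one, one_mul, h2]
    refine le_trans (le_of_eq ?_) h1
    rw [show ccStar α (a - b) = ccStar α a - ccStar α b from ccStar_sub α a b]
    exact dist_eq_norm (E := CcAlg μ R) _ _
  exact Completion.map_coe (α := CcAlg μ R) (β := CcAlg μ R) h.uniformContinuous f

/-- `T` is an involutive representation of the crossed product: the representation space is a
Hilbert space and `T(b^*) = T(b)^*`. -/
def IsInvolutiveRep {X : Type*} [NormedAddCommGroup X] [i : NormedSpace 𝕜 X]
    (T : CrossedProduct μ R →ₙₐ[𝕜] (X →L[𝕜] X)) : Prop :=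
  ∃ h : InnerProductSpace 𝕜 X, h.toNormedSpace = i ∧
    ∀ b x y, h.inner (T (cpStar μ R b) x) y = h.inner x (T b y)

end Star

/-- The representations of the crossed product in Banach spaces. -/
abbrev CPRep := Σ X : BanachSp.{v, w} 𝕜, CrossedProduct μ R →ₙₐ[𝕜] (X →L[𝕜] X)

/-- The map `(π, U) ↦ (π ⋊ U)^R` on `R`. -/
noncomputable def integration (p : R.carrier) : CPRep.{v, w} μ R :=
  ⟨p.1.1, intRep μ (isRCont_of_mem μ p.2)⟩

end CrossedProduct

end Defs

section Notions

variable {𝕜 : Type v} [RCLike 𝕜] {ι : Type*}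
  {X : Type*} [NormedAddCommGroup X] [NormedSpace 𝕜 X]
  {Y : Type*} [NormedAddCommGroup Y] [NormedSpace 𝕜 Y]

/-- Non-degeneracy: the linear span of all `T b x` is dense. -/
def Nondeg (T : ι → (X →L[𝕜] X)) : Prop :=
  Dense (Submodule.span 𝕜 {y | ∃ b x, T b x = y} : Set X)

/-- The subspace `Z` is invariant under all `T b`. -/
def Invariant (T : ι → (X →L[𝕜] X)) (Z : Submodule 𝕜 X) : Prop := ∀ b, ∀ z ∈ Z, T b z ∈ Z

/-- The bounded operator `Φ` intertwines `T` and `S`. -/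
def Intertwines (T : ι → (X →L[𝕜] X)) (S : ι → (Y →L[𝕜] Y)) (Φ : X →L[𝕜] Y) : Prop :=
  ∀ b, (S b).comp Φ = Φ.comp (T b)

/-- `A` has an `M`-bounded approximate left identity. The net is given by its filter of tails,
which is a filter on `A`. -/
def HasApproxLeftId (A : Type*) [NonUnitalNormedRing A] (M : ℝ) : Prop :=
  ∃ l : Filter A, l.NeBot ∧ (∀ᶠ u in l, ‖u‖ ≤ M) ∧ ∀ a, Tendsto (fun u => u * a) l (𝓝 a)

variable {A : Type*} [NonUnitalNormedRing A] [NormedSpace 𝕜 A]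
  {G : Type*} [Group G] [TopologicalSpace G]

/-- The class of all non-degenerate continuous covariant representations `(π, U)` in spaces from
`𝒳` with `π` contractive and every `U r` isometric. -/
def isomSet (α : DynSys 𝕜 A G) (𝒳 : Set (BanachSp.{v, w} 𝕜)) :
    Set (Σ X : BanachSp.{v, w} 𝕜, ContCovRep α X) :=
  {p | p.1 ∈ 𝒳 ∧ Nondeg p.2.π ∧ (∀ a, ‖p.2.π a‖ ≤ ‖a‖) ∧ ∀ r, Isometry (p.2.U r)}

/-- `isomSet`, when non-empty, as a non-empty uniformly bounded class. -/
def isomClass (α : DynSys 𝕜 A G) (𝒳 : Set (BanachSp.{v, w} 𝕜)) (h : (isomSet α 𝒳).Nonempty) :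
    UBClass.{v, w} α where
  carrier := isomSet α 𝒳
  nonempty := h
  bounded := by
    refine ⟨1, zero_le_one, fun _ => 1, fun _ => zero_le_one, fun K _ => ⟨1, ?_⟩, fun p hp => ?_⟩
    · rintro _ ⟨_, _, rfl⟩
      exact le_rfl
    · refine ⟨fun a => by rw [one_mul]; exact hp.2.2.1 a, fun r => ?_⟩
      refine ContinuousLinearMap.opNorm_le_bound _ zero_le_one fun x => ?_
      rw [one_mul]
      exact ((AddMonoidHomClass.isometry_iff_norm (p.2.U r)).1 (hp.2.2.2 r) x).le

end Notions

end CrossedProd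

/-!
Both `A` and `G` act on `(A ⋊_α G)^R` by left multipliers: `i_A a` extends `f ↦ (s ↦ a f(s))` and
`i_G t` extends `f ↦ (s ↦ α_t (f (t⁻¹ s)))`. When `R` consists of contractive representations,
`(i_A, i_G)` is a contractive covariant representation whose integrated form is left
multiplication. The elements `φ ⊗ u`, with `φ` a bump of integral one near `1` and `u` from an
approximate left identity of `A`, form an approximate left identity of the crossed product with
the same bound. Hence a non-degenerate contractive representation `T` of the crossed product
extends to left multipliers, `T (L b) x = S (T b x)`, with `‖S‖ ≤ (1 + ε) ‖L‖` for every `ε > 0`;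
applied to `i_A a` and `i_G t`, this produces the covariant representation integrating to `T`.

Conversely, `π a` and `U t` are recovered as strong limits of integrated forms of bump functions,
so that equality, closed invariant subspaces and bounded intertwiners pass between `(π, U)` and its
integrated form.
-/

namespace CrossedProd

section Operators

variable {𝕜 : Type*} [NontriviallyNormedField 𝕜] {X : Type*} [SeminormedAddCommGroup X]
  [NormedSpace 𝕜 X] {Y : Type*} [SeminormedAddCommGroup Y] [NormedSpace 𝕜 Y]
  {ι : Type*} {l : Filter ι} {Ψ : ι → X →L[𝕜] Y} {M : ℝ}

theorem tendsto_clm_apply_of_norm_le (hM : ∀ᶠ i in l, ‖Ψ i‖ ≤ M) {y : ι → X} {y₀ : X}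
    (hy : Tendsto y l (𝓝 y₀)) {z : Y} (h : Tendsto (fun i => Ψ i y₀) l (𝓝 z)) :
    Tendsto (fun i => Ψ i (y i)) l (𝓝 z) := by
  have hsub : Tendsto (fun i => Ψ i (y i - y₀)) l (𝓝 0) :=
    (tendsto_sub_nhds_zero_iff.2 hy).op_zero_isBoundedUnder_le
      (isBoundedUnder_of_eventually_le hM) (fun x Φ => Φ x)
      fun x Φ => (Φ.le_opNorm x).trans_eq (mul_comm _ _)
  simpa only [map_sub, sub_add_cancel, zero_add] using hsub.add h

theorem tendsto_clm_apply_of_dense_span {Φ : X →L[𝕜] Y} (hM : ∀ᶠ i in l, ‖Ψ i‖ ≤ M) {S : Set X}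
    (hS : Dense (Submodule.span 𝕜 S : Set X))
    (h : ∀ x ∈ S, Tendsto (fun i => Ψ i x) l (𝓝 (Φ x))) (x : X) :
    Tendsto (fun i => Ψ i x) l (𝓝 (Φ x)) := by
  have hspan : ∀ y ∈ Submodule.span 𝕜 S, Tendsto (fun i => Ψ i y) l (𝓝 (Φ y)) := fun y hy => by
    induction hy using Submodule.span_induction with
    | mem y hy => exact h y hy
    | zero => simpa only [map_zero] using tendsto_const_nhds
    | add y z _ _ hy hz => simpa only [map_add] using hy.add hz
    | smul c y _ hy => simpa only [map_smul] using hy.const_smul c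
  have hrange : range ((↑) : {i | ‖Ψ i‖ ≤ M} → ι) ∈ l := by rwa [Subtype.range_coe]
  have hequi : Equicontinuous fun (i : {i | ‖Ψ i‖ ≤ M}) y => Ψ i y :=
    ((NormedSpace.equicontinuous_TFAE fun i : {i | ‖Ψ i‖ ≤ M} => Ψ i).out 5 1 :
      (∃ C, ∀ i : {i | ‖Ψ i‖ ≤ M}, ‖Ψ i‖ ≤ C) ↔ _).1 ⟨M, Subtype.prop⟩
  have hclosed := hequi.isClosed_setOfPred_tendsto (l := comap (↑) l) Φ.continuous
  refine (tendsto_comap'_iff hrange).1 (closure_minimal (fun y hy => ?_) hclosed (hS x))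
  exact (tendsto_comap'_iff hrange).2 (hspan y hy)

theorem tendstoUniformlyOn_of_isCompact {Φ : X →L[𝕜] Y} (hM : ∀ᶠ i in l, ‖Ψ i‖ ≤ M)
    (h : ∀ x, Tendsto (fun i => Ψ i x) l (𝓝 (Φ x))) {K : Set X} (hK : IsCompact K) :
    TendstoUniformlyOn (fun i x => Ψ i x) Φ l K := by
  refine (tendstoLocallyUniformlyOn_iff_tendstoUniformlyOn_of_compact hK).1
    (TendstoLocallyUniformly.tendstoLocallyUniformlyOn ?_)
  refine tendstoLocallyUniformly_iff_forall_tendsto.2 fun x => ?_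
  have hΨ : Tendsto (fun q : ι × X => Ψ q.1 q.2) (l ×ˢ 𝓝 x) (𝓝 (Φ x)) :=
    tendsto_clm_apply_of_norm_le (tendsto_fst.eventually hM) tendsto_snd ((h x).comp tendsto_fst)
  exact (((Φ.continuous.tendsto x).comp tendsto_snd).prodMk_nhds hΨ).mono_right
    (nhds_le_uniformity _)

end Operators

section Nondegenerate

variable {𝕜 : Type*} [RCLike 𝕜] {X : Type*} [NormedAddCommGroup X] [NormedSpace 𝕜 X]
  {ι κ : Type*} {T : ι → X →L[𝕜] X}

theorem Nondeg.ext {Y : Type*} [NormedAddCommGroup Y] [NormedSpace 𝕜 Y] (hT : Nondeg T)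
    {P Q : X →L[𝕜] Y} (h : ∀ b x, P (T b x) = Q (T b x)) : P = Q := by
  refine ContinuousLinearMap.ext_on hT ?_
  rintro _ ⟨b, x, rfl⟩
  exact h b x

theorem Nondeg.of_mem_closure (hT : Nondeg T) {S : κ → X →L[𝕜] X}
    (h : ∀ b x, T b x ∈ closure {y | ∃ c z, S c z = y}) : Nondeg S := by
  have hspan : Submodule.span 𝕜 {y | ∃ b x, T b x = y} ≤
      (Submodule.span 𝕜 {y | ∃ c z, S c z = y}).topologicalClosure := by
    rw [Submodule.span_le]
    rintro _ ⟨b, x, rfl⟩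
    exact closure_mono Submodule.subset_span (h b x)
  exact dense_closure.1 (hT.mono hspan)

theorem isClosed_setOf_mapsTo {B : Type*} [TopologicalSpace B] {T : B → X →L[𝕜] X}
    (hT : Continuous T) {Z : Set X} (hZ : IsClosed Z) : IsClosed {b | ∀ z ∈ Z, T b z ∈ Z} := by
  simp only [ofPred_forall]
  exact isClosed_iInter fun z => isClosed_iInter fun _ =>
    hZ.preimage (hT.clm_apply continuous_const)

theorem isometry_of_norm_le_one {G : Type*} [Group G] (U : G →* (X →L[𝕜] X))
    (hU : ∀ s, ‖U s‖ ≤ 1) (s : G) : Isometry (U s) := by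
  refine (AddMonoidHomClass.isometry_iff_norm (U s)).2 fun x => le_antisymm ?_ ?_
  · simpa only [one_mul] using (U s).le_of_opNorm_le (hU s) x
  · have hinv : U s⁻¹ (U s x) = x := by
      rw [← mul_apply_eq_comp, ← map_mul, inv_mul_cancel, map_one, one_apply_eq_self]
    simpa only [one_mul, hinv] using (U s⁻¹).le_of_opNorm_le (hU s⁻¹) (U s x)

variable {B : Type*} [NonUnitalNormedRing B] [NormedSpace 𝕜 B]

theorem Nondeg.tendsto_approxLeftId {S : B →ₙₐ[𝕜] (X →L[𝕜] X)} (hS : Nondeg S)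
    (hcont : Continuous S) {l : Filter B} {M : ℝ} (hM : ∀ᶠ u in l, ‖S u‖ ≤ M)
    (hl : ∀ b, Tendsto (fun u => u * b) l (𝓝 b)) (x : X) : Tendsto (fun u => S u x) l (𝓝 x) := by
  refine tendsto_clm_apply_of_dense_span (Φ := ContinuousLinearMap.id 𝕜 X) hM hS ?_ x
  rintro _ ⟨b, y, rfl⟩
  refine (((hcont.clm_apply continuous_const).tendsto b).comp (hl b)).congr fun u => ?_
  rw [Function.comp_apply, map_mul, mul_apply_eq_comp]

end Nondegenerate

open TensorProduct

section TensorEval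

variable {𝕜 : Type*} [RCLike 𝕜] {V : Type*} [AddCommGroup V] [Module 𝕜 V]
  {X : Type*} [NormedAddCommGroup X] [NormedSpace 𝕜 X]

/-- The evaluation map `b ⊗ x ↦ T b x`, which is onto a dense subspace of `X` if `T` is
non-degenerate. -/
def tensorEval (T : V →ₗ[𝕜] (X →L[𝕜] X)) : V ⊗[𝕜] X →ₗ[𝕜] X :=
  TensorProduct.lift ((ContinuousLinearMap.coeLM 𝕜).comp T)

theorem tensorEval_tmul (T : V →ₗ[𝕜] (X →L[𝕜] X)) (b : V) (x : X) :
    tensorEval T (b ⊗ₜ x) = T b x := rfl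

theorem Nondeg.denseRange_tensorEval {T : V →ₗ[𝕜] (X →L[𝕜] X)} (hT : Nondeg T) :
    DenseRange (tensorEval T) := by
  have hspan : Submodule.span 𝕜 {y | ∃ b x, T b x = y} ≤ LinearMap.range (tensorEval T) := by
    rw [Submodule.span_le]
    rintro _ ⟨b, x, rfl⟩
    exact ⟨b ⊗ₜ x, rfl⟩
  exact hT.mono hspan

end TensorEval

section LeftMultipliers

variable {𝕜 : Type*} [RCLike 𝕜] {B : Type*} [NonUnitalNormedRing B] [NormedSpace 𝕜 B]
  {X : Type*} [NormedAddCommGroup X] [NormedSpace 𝕜 X]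

/-- The bounded operator `L` on `B` is a left multiplier (a left centralizer) of `B`. -/
def IsLeftMultiplier (L : B →L[𝕜] B) : Prop := ∀ b c, L (b * c) = L b * c

variable {T : B →ₙₐ[𝕜] (X →L[𝕜] X)} {L : B →L[𝕜] B}

theorem IsLeftMultiplier.tendsto_tensorEval (hL : IsLeftMultiplier L) (hT : Continuous T)
    {l : Filter B} (hl : ∀ b, Tendsto (fun u => u * b) l (𝓝 b)) (t : B ⊗[𝕜] X) :
    Tendsto (fun u => T (L u) (tensorEval (T : B →ₗ[𝕜] (X →L[𝕜] X)) t)) l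
      (𝓝 (tensorEval ((T : B →ₗ[𝕜] (X →L[𝕜] X)).comp (L : B →ₗ[𝕜] B)) t)) := by
  induction t using TensorProduct.induction_on with
  | zero => simpa only [map_zero] using tendsto_const_nhds
  | add s t hs ht => simpa only [map_add] using hs.add ht
  | tmul b x =>
    have hcont : Continuous fun c => T (L c) x :=
      (hT.comp L.continuous).clm_apply continuous_const
    refine ((hcont.tendsto b).comp (hl b)).congr fun u => ?_
    rw [Function.comp_apply, hL, map_mul, mul_apply_eq_comp, tensorEval_tmul]
    rfl

theorem IsLeftMultiplier.norm_tensorEval_le (hL : IsLeftMultiplier L)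
    (hB : ∀ ε : ℝ, 0 < ε → HasApproxLeftId B (1 + ε)) (hT : ∀ b, ‖T b‖ ≤ ‖b‖) (t : B ⊗[𝕜] X) :
    ‖tensorEval ((T : B →ₗ[𝕜] (X →L[𝕜] X)).comp (L : B →ₗ[𝕜] B)) t‖ ≤
      ‖L‖ * ‖tensorEval (T : B →ₗ[𝕜] (X →L[𝕜] X)) t‖ := by
  refine (le_iff_forall_one_lt_le_mul₀ (by positivity)).2 fun c hc => ?_
  obtain ⟨l, hl, hlc, hlim⟩ := hB (c - 1) (sub_pos.2 hc)
  rw [add_sub_cancel] at hlc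
  have hTc : Continuous T :=
    AddMonoidHomClass.continuous_of_bound T 1 (by simpa only [one_mul] using hT)
  refine le_of_tendsto (hL.tendsto_tensorEval hTc hlim t).norm (hlc.mono fun u hu => ?_)
  set y := tensorEval (T : B →ₗ[𝕜] (X →L[𝕜] X)) t
  calc ‖T (L u) y‖ ≤ ‖L u‖ * ‖y‖ := (T _).le_of_opNorm_le (hT _) y
    _ ≤ ‖L‖ * c * ‖y‖ := by gcongr; exact L.le_of_opNorm_le_of_le le_rfl hu
    _ = ‖L‖ * ‖y‖ * c := by ring

theorem IsLeftMultiplier.exists_extension [CompleteSpace X] (hL : IsLeftMultiplier L)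
    (hB : ∀ ε : ℝ, 0 < ε → HasApproxLeftId B (1 + ε)) (hT : Nondeg T) (hb : ∀ b, ‖T b‖ ≤ ‖b‖) :
    ∃ S : X →L[𝕜] X, (∀ b x, S (T b x) = T (L b) x) ∧ ‖S‖ ≤ ‖L‖ := by
  have hdense : DenseRange (tensorEval (T : B →ₗ[𝕜] (X →L[𝕜] X))) := Nondeg.denseRange_tensorEval hT
  have hbound := hL.norm_tensorEval_le hB hb
  exact ⟨LinearMap.extendOfNorm _ _,
    fun b x => LinearMap.extendOfNorm_eq hdense ⟨_, hbound⟩ (b ⊗ₜ x),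
    LinearMap.opNorm_extendOfNorm_le hdense (norm_nonneg _) hbound⟩

theorem exists_contCovRep_of_isLeftMultiplier [CompleteSpace X] [CompleteSpace B]
    {A : Type*} [NonUnitalNormedRing A] [NormedSpace 𝕜 A] {G : Type*} [Group G] [TopologicalSpace G]
    [LocallyCompactSpace G] {α : DynSys 𝕜 A G} {q : ContCovRep α B}
    (hπ : ∀ a, IsLeftMultiplier (q.π a)) (hU : ∀ s, IsLeftMultiplier (q.U s))
    (hB : ∀ ε : ℝ, 0 < ε → HasApproxLeftId B (1 + ε)) (hT : Nondeg T) (hb : ∀ b, ‖T b‖ ≤ ‖b‖) :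
    ∃ p : ContCovRep α X, (∀ a b x, p.π a (T b x) = T (q.π a b) x) ∧
      (∀ s b x, p.U s (T b x) = T (q.U s b) x) ∧ (∀ a, ‖p.π a‖ ≤ ‖q.π a‖) ∧
        ∀ s, ‖p.U s‖ ≤ ‖q.U s‖ := by
  choose π hπT hπn using fun a => (hπ a).exists_extension hB hT hb
  choose U hUT hUn using fun s => (hU s).exists_extension hB hT hb
  have hTc : Continuous T :=
    AddMonoidHomClass.continuous_of_bound T 1 (by simpa only [one_mul] using hb)
  have hUc (x : X) : Continuous fun s => U s x := continuous_iff_continuousAt.2 fun t => by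
    obtain ⟨K, hK, hKt⟩ := exists_compact_mem_nhds t
    obtain ⟨M, -, hM⟩ := exists_bound_on_compact q.continuous_U hK
    refine tendsto_clm_apply_of_dense_span (M := M)
      (eventually_of_mem hKt fun s hs => (hUn s).trans (hM s hs)) hT ?_ x
    rintro _ ⟨b, y, rfl⟩
    have hcont := (hTc.comp (q.continuous_U b)).clm_apply (continuous_const (y := y))
    simpa only [hUT, Function.comp_apply] using hcont.tendsto t
  obtain ⟨C, hC⟩ := q.bounded
  let p : ContCovRep α X :=
    { π :=
        { toFun := π
          map_smul' := fun c a => hT.ext fun b x => by simp [hπT]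
          map_zero' := hT.ext fun b x => by simp [hπT]
          map_add' := fun a a' => hT.ext fun b x => by simp [hπT]
          map_mul' := fun a a' => hT.ext fun b x => by simp [hπT] }
      U :=
        { toFun := U
          map_one' := hT.ext fun b x => by simp [hUT]
          map_mul' := fun s t => hT.ext fun b x => by simp [hUT] }
      covariant := fun a s => hT.ext fun b x => by simp [hUT, hπT, q.covariant]
      bounded := ⟨C, fun a => (hπn a).trans (hC a)⟩
      continuous_U := hUc }
  exact ⟨p, hπT, hUT, hπn, hUn⟩

end LeftMultipliers

section Bumps

variable {G : Type*} [TopologicalSpace G] (𝕜 : Type*) [RCLike 𝕜] {E : Type*} [NormedAddCommGroup E]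
  [NormedSpace 𝕜 E]

theorem continuous_ofReal_smul (φ : C_c(G, ℝ)) {h : G → E} (hh : Continuous h) :
    Continuous fun s => (φ s : 𝕜) • h s :=
  (RCLike.continuous_ofReal.comp φ.continuous).smul hh

theorem hasCompactSupport_ofReal_smul (φ : C_c(G, ℝ)) (h : G → E) :
    HasCompactSupport fun s => (φ s : 𝕜) • h s :=
  (φ.hasCompactSupport.comp_left RCLike.ofReal_zero).smul_right

variable [MeasurableSpace G] (μ : Measure G) {V : Set G}

/-- The non-negative functions in `C_c(G)` of integral one that vanish outside `V`. -/
def bumps (V : Set G) : Set C_c(G, ℝ) :=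
  {φ | (∀ s, 0 ≤ φ s) ∧ ∫ s, φ s ∂μ = 1 ∧ ∀ s ∉ V, φ s = 0}

theorem bumps_mono : Monotone (bumps μ) := fun _ _ hVW _ hφ =>
  ⟨hφ.1, hφ.2.1, fun s hs => hφ.2.2 s (notMem_subset hVW hs)⟩

/-- The filter on `C_c(G)` generated by the sets `bumps μ V`, where `V` runs through the
neighbourhoods of `1`; along it, `φ dμ` approximates the point mass at `1`. -/
def bumpFilter [One G] : Filter C_c(G, ℝ) := (𝓝 (1 : G)).lift' (bumps μ)

theorem eventually_mem_bumps [One G] {V : Set G} (hV : V ∈ 𝓝 (1 : G)) :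
    ∀ᶠ φ in bumpFilter μ, φ ∈ bumps μ V := mem_lift' hV

variable {μ}

theorem integral_norm_ofReal_smul_le [OpensMeasurableSpace G] [IsFiniteMeasureOnCompacts μ]
    {φ : C_c(G, ℝ)} (hφ : φ ∈ bumps μ V) {h : G → E} {C : ℝ} (hC : ∀ s ∈ V, ‖h s‖ ≤ C) :
    ∫ s, ‖(φ s : 𝕜) • h s‖ ∂μ ≤ C := by
  have hint : Integrable (fun s => φ s * C) μ :=
    (φ.continuous.integrable_of_hasCompactSupport φ.hasCompactSupport).mul_const C
  have hle (s : G) : ‖(φ s : 𝕜) • h s‖ ≤ φ s * C := by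
    rw [norm_smul, RCLike.norm_ofReal, abs_of_nonneg (hφ.1 s)]
    by_cases hs : s ∈ V
    · exact mul_le_mul_of_nonneg_left (hC s hs) (hφ.1 s)
    · rw [hφ.2.2 s hs, zero_mul, zero_mul]
  calc ∫ s, ‖(φ s : 𝕜) • h s‖ ∂μ ≤ ∫ s, φ s * C ∂μ :=
        integral_mono_of_nonneg (ae_of_all _ fun _ => norm_nonneg _) hint (ae_of_all _ hle)
    _ = C := by rw [integral_mul_const, hφ.2.1, one_mul]

end Bumps

section Vint

variable (𝕜 : Type*) [RCLike 𝕜] {G : Type*} [TopologicalSpace G] [MeasurableSpace G]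
  [OpensMeasurableSpace G] {μ : Measure G} [IsFiniteMeasureOnCompacts μ] {E : Type*}
  [NormedAddCommGroup E] [NormedSpace 𝕜 E] [CompleteSpace E]

theorem vint_ofReal_smul_const (φ : C_c(G, ℝ)) (c : E) :
    vint 𝕜 μ (fun s => (φ s : 𝕜) • c) = ((∫ s, φ s ∂μ : ℝ) : 𝕜) • c := by
  have hcont : Continuous fun s => (φ s : 𝕜) := RCLike.continuous_ofReal.comp φ.continuous
  have hmap := map_vint 𝕜 (μ := μ) (ContinuousLinearMap.toSpanSingleton 𝕜 c) hcont
    (φ.hasCompactSupport.comp_left RCLike.ofReal_zero)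
  rw [vint_eq_integral, integral_ofReal] at hmap
  exact hmap.symm

theorem vint_mem {f : G → E} (hf : Continuous f) (hf' : HasCompactSupport f)
    {Z : Submodule 𝕜 E} (hZ : IsClosed (Z : Set E)) (h : ∀ s, f s ∈ Z) : vint 𝕜 μ f ∈ Z := by
  have : CompleteSpace Z := hZ.completeSpace_coe
  let g (s : G) : Z := ⟨f s, h s⟩
  have hg : HasCompactSupport g :=
    .mono' hf' fun s hs => subset_tsupport f fun h0 => hs (Subtype.ext h0)
  have hmap : ((vint 𝕜 μ g : Z) : E) = vint 𝕜 μ f :=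
    map_vint 𝕜 (μ := μ) Z.subtypeL (hf.subtype_mk _) hg
  exact hmap ▸ (vint 𝕜 μ g).2

theorem tendsto_vint_ofReal_smul [One G] {h : G → E} (hh : Continuous h) :
    Tendsto (fun φ : C_c(G, ℝ) => vint 𝕜 μ fun s => (φ s : 𝕜) • h s) (bumpFilter μ)
      (𝓝 (h 1)) := by
  refine Metric.nhds_basis_closedBall.tendsto_right_iff.2 fun ε hε => ?_
  have hV : {s | ‖h s - h 1‖ ≤ ε} ∈ 𝓝 (1 : G) :=
    ((hh.sub continuous_const).norm.tendsto' 1 0 (by simp)).eventually (ge_mem_nhds hε)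
  filter_upwards [eventually_mem_bumps μ hV] with φ hφ
  have hsub : Continuous fun s => h s - h 1 := hh.sub continuous_const
  have hadd := vint_add 𝕜 (μ := μ) (continuous_ofReal_smul 𝕜 φ hsub)
    (hasCompactSupport_ofReal_smul 𝕜 φ _) (continuous_ofReal_smul 𝕜 φ continuous_const)
    (hasCompactSupport_ofReal_smul 𝕜 φ fun _ => h 1)
  simp only [← smul_add, sub_add_cancel, vint_ofReal_smul_const, hφ.2.1, RCLike.ofReal_one,
    one_smul] at hadd
  rw [hadd, mem_closedBall_iff_norm, add_sub_cancel_right]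
  exact (norm_vint_le 𝕜 μ _).trans (integral_norm_ofReal_smul_le 𝕜 hφ fun _ hs => hs)

end Vint

section BumpFilter

variable {G : Type*} [Group G] [TopologicalSpace G] [IsTopologicalGroup G] [LocallyCompactSpace G]
  [MeasurableSpace G] [BorelSpace G] (μ : Measure G) [μ.IsHaarMeasure]

theorem bumps_nonempty {V : Set G} (hV : V ∈ 𝓝 (1 : G)) : (bumps μ V).Nonempty := by
  obtain ⟨f, hf1, hf0, hfc, hf⟩ := exists_continuous_one_zero_of_isCompact
    (isCompact_singleton (x := (1 : G))) (isOpen_interior (s := V)).isClosed_compl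
    (disjoint_compl_right_iff_subset.2 (singleton_subset_iff.2 (mem_interior_iff_mem_nhds.2 hV)))
  have hpos : 0 < ∫ s, f s ∂μ :=
    f.continuous.integral_pos_of_hasCompactSupport_nonneg_nonzero hfc (fun s => (hf s).1)
      (x := 1) (by rw [hf1 (mem_singleton 1)]; exact one_ne_zero)
  refine ⟨(∫ s, f s ∂μ)⁻¹ • ⟨f, hfc⟩, fun s => ?_, ?_, fun s hs => ?_⟩
  · exact mul_nonneg (inv_nonneg.2 hpos.le) (hf s).1
  · exact (integral_const_mul _ _).trans (inv_mul_cancel₀ hpos.ne')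
  · exact mul_eq_zero_of_right _ (hf0 fun hs' => hs (interior_subset hs'))

instance : (bumpFilter μ).NeBot :=
  (lift'_neBot_iff (bumps_mono μ)).2 fun _ => bumps_nonempty μ

end BumpFilter

section IntegratedForms

variable {𝕜 : Type v} [RCLike 𝕜]
  {A : Type*} [NonUnitalNormedRing A] [NormedSpace 𝕜 A]
  {G : Type*} [Group G] [TopologicalSpace G] {α : DynSys 𝕜 A G}
  {X : Type*} [NormedAddCommGroup X] [NormedSpace 𝕜 X]
  {Y : Type*} [NormedAddCommGroup Y] [NormedSpace 𝕜 Y]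

variable (𝕜) in
/-- The elementary tensor `φ ⊗ a : s ↦ φ(s) a` in `C_c(G, A)`. -/
def ccTensor (φ : C_c(G, ℝ)) (a : A) : C_c(G, A) where
  toFun s := (φ s : 𝕜) • a
  continuous_toFun := continuous_ofReal_smul 𝕜 φ continuous_const
  hasCompactSupport' := hasCompactSupport_ofReal_smul 𝕜 φ _

/-- The left action `f ↦ (s ↦ a f(s))` of an element of `A` on `C_c(G, A)`. -/
def ccMulLeft [SMulCommClass 𝕜 A A] (a : A) : C_c(G, A) →ₗ[𝕜] C_c(G, A) where
  toFun f := ⟨⟨fun s => a * f s, by fun_prop⟩, f.hasCompactSupport.mul_left⟩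
  map_add' f g := CompactlySupportedContinuousMap.ext fun s => mul_add a (f s) (g s)
  map_smul' c f := CompactlySupportedContinuousMap.ext fun s => mul_smul_comm c a (f s)

theorem ContCovRep.exists_eventually_norm_π_le (p : ContCovRep α X) {l : Filter A} {M : ℝ}
    (hM : ∀ᶠ u in l, ‖u‖ ≤ M) : ∃ C, ∀ᶠ u in l, ‖p.π u‖ ≤ C := by
  obtain ⟨C, hC⟩ := p.bounded
  exact ⟨|C| * M, hM.mono fun u hu => (hC u).trans (by gcongr; exact le_abs_self C)⟩

variable [IsTopologicalGroup G]

variable (α) in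
/-- The left action `f ↦ (s ↦ α_t(f(t⁻¹ s)))` of an element of `G` on `C_c(G, A)`. -/
def ccTranslate (t : G) : C_c(G, A) →ₗ[𝕜] C_c(G, A) where
  toFun f :=
    ⟨⟨fun s => α.act t (f (t⁻¹ * s)), by fun_prop⟩,
      (f.hasCompactSupport.comp_homeomorph (Homeomorph.mulLeft t⁻¹)).comp_left
        (map_zero (α.act t))⟩
  map_add' f g := CompactlySupportedContinuousMap.ext fun s =>
    map_add (α.act t) (f (t⁻¹ * s)) (g (t⁻¹ * s))
  map_smul' c f := CompactlySupportedContinuousMap.ext fun s =>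
    map_smul (α.act t) c (f (t⁻¹ * s))

variable [LocallyCompactSpace G] [T2Space G] [MeasurableSpace G] [BorelSpace G] (μ : Measure G)
  [μ.IsHaarMeasure] [IsScalarTower 𝕜 A A] [SMulCommClass 𝕜 A A] [CompleteSpace A] [CompleteSpace X]
  [CompleteSpace Y]

theorem intForm_ccTensor (p : ContCovRep α X) (φ : C_c(G, ℝ)) (a : A) (x : X) :
    intForm μ p (ccTensor 𝕜 φ a) x = p.π a (vint 𝕜 μ fun s => (φ s : 𝕜) • p.U s x) := by
  rw [intForm_apply, map_vint 𝕜 _ (continuous_ofReal_smul 𝕜 φ (p.continuous_U x))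
    (hasCompactSupport_ofReal_smul 𝕜 φ _)]
  refine congrArg (vint 𝕜 μ) (funext fun s => ?_)
  rw [map_smul]
  exact DFunLike.congr_fun (map_smul p.π (φ s : 𝕜) a) (p.U s x)

theorem intForm_ccMulLeft (p : ContCovRep α X) (a : A) (f : C_c(G, A)) :
    intForm μ p (ccMulLeft (𝕜 := 𝕜) a f) = p.π a * intForm μ p f := by
  ext x
  have h := intIntegrand p f x
  rw [mul_apply_eq_comp, intForm_apply, intForm_apply, map_vint 𝕜 _ h.1 h.2]
  exact congrArg (vint 𝕜 μ) (funext fun s =>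
    DFunLike.congr_fun (map_mul p.π a (f s)) (p.U s x))

theorem intForm_ccTranslate (p : ContCovRep α X) (t : G) (f : C_c(G, A)) :
    intForm μ p (ccTranslate α t f) = p.U t * intForm μ p f := by
  ext x
  have h := intIntegrand p f x
  rw [mul_apply_eq_comp, intForm_apply, intForm_apply, map_vint 𝕜 _ h.1 h.2,
    ← vint_mul_left 𝕜 μ _ t]
  refine congrArg (vint 𝕜 μ) (funext fun s => ?_)
  change p.π (α.act t (f (t⁻¹ * (t * s)))) (p.U (t * s) x) = p.U t (p.π (f s) (p.U s x))
  rw [p.covariant, inv_mul_cancel_left, mul_apply_eq_comp, mul_apply_eq_comp,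
    ← mul_apply_eq_comp (p.U t⁻¹), ← map_mul, inv_mul_cancel_left]

theorem tendsto_intForm_ccTensor (p : ContCovRep α X) (a : A) (x : X) :
    Tendsto (fun φ => intForm μ p (ccTensor 𝕜 φ a) x) (bumpFilter μ) (𝓝 (p.π a x)) := by
  have hU : Tendsto _ (bumpFilter μ) (𝓝 (p.U 1 x)) :=
    tendsto_vint_ofReal_smul 𝕜 (p.continuous_U x)
  rw [map_one, one_apply_eq_self] at hU
  simp only [intForm_ccTensor]
  exact ((p.π a).continuous.tendsto x).comp hU

theorem tendsto_intForm_ccTensor_approxLeftId (p : ContCovRep α X) {l : Filter A} {M : ℝ}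
    (hM : ∀ᶠ u in l, ‖u‖ ≤ M) {x : X} (hx : Tendsto (fun u => p.π u x) l (𝓝 x)) :
    Tendsto (fun q : C_c(G, ℝ) × A => intForm μ p (ccTensor 𝕜 q.1 q.2) x) (bumpFilter μ ×ˢ l)
      (𝓝 x) := by
  obtain ⟨C, hC⟩ := p.exists_eventually_norm_π_le hM
  have hU : Tendsto _ (bumpFilter μ) (𝓝 (p.U 1 x)) :=
    tendsto_vint_ofReal_smul 𝕜 (p.continuous_U x)
  rw [map_one, one_apply_eq_self] at hU
  simp only [intForm_ccTensor]
  exact tendsto_clm_apply_of_norm_le (tendsto_snd.eventually hC) (hU.comp tendsto_fst)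
    (hx.comp tendsto_snd)

theorem nondeg_intForm {p : ContCovRep α X} (hp : Nondeg p.π) : Nondeg (intForm μ p) :=
  hp.of_mem_closure fun a x => mem_closure_of_tendsto (tendsto_intForm_ccTensor μ p a x)
    (Eventually.of_forall fun _ => ⟨_, _, rfl⟩)

theorem Intertwines.intForm {p : ContCovRep α X} {q : ContCovRep α Y} {Φ : X →L[𝕜] Y}
    (hπ : Intertwines p.π q.π Φ) (hU : Intertwines p.U q.U Φ) :
    Intertwines (intForm μ p) (intForm μ q) Φ := fun f => by
  ext x
  have h := intIntegrand p f x
  rw [ContinuousLinearMap.comp_apply, ContinuousLinearMap.comp_apply, intForm_apply,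
    intForm_apply, map_vint 𝕜 _ h.1 h.2]
  refine congrArg (vint 𝕜 μ) (funext fun s => ?_)
  calc q.π (f s) (q.U s (Φ x)) = q.π (f s) (Φ (p.U s x)) :=
        congrArg _ (DFunLike.congr_fun (hU s) x)
    _ = Φ (p.π (f s) (p.U s x)) := DFunLike.congr_fun (hπ (f s)) (p.U s x)

theorem intertwines_intForm_iff {p : ContCovRep α X} {q : ContCovRep α Y} (hp : Nondeg p.π)
    (Φ : X →L[𝕜] Y) :
    Intertwines p.π q.π Φ ∧ Intertwines p.U q.U Φ ↔
      Intertwines (intForm μ p) (intForm μ q) Φ := by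
  refine ⟨fun h => h.1.intForm μ h.2, fun h => ⟨fun a => ?_, fun t => ?_⟩⟩
  · ext x
    refine tendsto_nhds_unique (tendsto_intForm_ccTensor μ q a (Φ x)) ?_
    refine ((Φ.continuous.tendsto _).comp (tendsto_intForm_ccTensor μ p a x)).congr fun φ => ?_
    exact (DFunLike.congr_fun (h (ccTensor 𝕜 φ a)) x).symm
  · refine (nondeg_intForm μ hp).ext fun f x => ?_
    calc q.U t (Φ (intForm μ p f x)) = q.U t (intForm μ q f (Φ x)) :=
          congrArg _ (DFunLike.congr_fun (h f) x).symm
      _ = intForm μ q (ccTranslate α t f) (Φ x) := by rw [intForm_ccTranslate]; rfl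
      _ = Φ (intForm μ p (ccTranslate α t f) x) := DFunLike.congr_fun (h _) x
      _ = Φ (p.U t (intForm μ p f x)) := by rw [intForm_ccTranslate]; rfl

theorem covRep_ext_of_intForm {p q : ContCovRep α X} (hp : Nondeg p.π)
    (h : ∀ f, intForm μ p f = intForm μ q f) : p = q := by
  obtain ⟨hπ, hU⟩ := (intertwines_intForm_iff μ (q := q) hp (ContinuousLinearMap.id 𝕜 X)).2
    fun f => congrArg (·.comp (ContinuousLinearMap.id 𝕜 X)) (h f).symm
  obtain ⟨⟨π, U, _⟩, _, _⟩ := p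
  obtain ⟨⟨ρ, V, _⟩, _, _⟩ := q
  obtain rfl : π = ρ := NonUnitalAlgHom.ext fun a => (hπ a).symm
  obtain rfl : U = V := MonoidHom.ext fun t => (hU t).symm
  rfl

theorem invariant_intForm_iff {p : ContCovRep α X} (hp : Nondeg p.π) {M : ℝ}
    (hA : HasApproxLeftId A M) {Z : Submodule 𝕜 X} (hZ : IsClosed (Z : Set X)) :
    Invariant p.π Z ∧ Invariant p.U Z ↔ Invariant (intForm μ p) Z := by
  refine ⟨fun h f z hz => ?_, fun h => ⟨fun a z hz => ?_, fun t z hz => ?_⟩⟩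
  · have hcont := intIntegrand p f z
    exact vint_mem 𝕜 hcont.1 hcont.2 hZ fun s => h.1 _ _ (h.2 _ _ hz)
  · exact hZ.mem_of_tendsto (tendsto_intForm_ccTensor μ p a z) (.of_forall fun _ => h _ z hz)
  · obtain ⟨l, _, hM, hlim⟩ := hA
    obtain ⟨C, hC⟩ := p.exists_eventually_norm_π_le hM
    have hz' := tendsto_intForm_ccTensor_approxLeftId μ p hM
      (hp.tendsto_approxLeftId p.continuous_π hC hlim z)
    refine hZ.mem_of_tendsto (((p.U t).continuous.tendsto z).comp hz') (.of_forall fun q => ?_)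
    rw [Function.comp_apply, ← mul_apply_eq_comp, ← intForm_ccTranslate]
    exact h _ z hz

end IntegratedForms

section UniformConvergence

variable {G : Type*} [MeasurableSpace G] {μ : Measure G} {E : Type*} [NormedAddCommGroup E]
  {ι : Type*} {l : Filter ι} {K : Set G} {F : ι → G → E} {f : G → E}

theorem tendsto_integral_norm_sub_of_tendstoUniformlyOn (hK : μ K < ⊤)
    (hF : ∀ᶠ i in l, ∀ s ∉ K, F i s = f s) (h : TendstoUniformlyOn F f l K) :
    Tendsto (fun i => ∫ s, ‖F i s - f s‖ ∂μ) l (𝓝 0) := by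
  refine Metric.nhds_basis_closedBall.tendsto_right_iff.2 fun ε hε => ?_
  obtain ⟨δ, hδ, hlt⟩ := exists_pos_mul_lt hε (μ.real K)
  filter_upwards [hF, Metric.tendstoUniformlyOn_iff.1 h δ hδ] with i hi hiK
  have hsupp : ∫ s in K, ‖F i s - f s‖ ∂μ = ∫ s, ‖F i s - f s‖ ∂μ :=
    setIntegral_eq_integral_of_forall_compl_eq_zero fun s hs => by
      rw [hi s hs, sub_self, norm_zero]
  rw [mem_closedBall_zero_iff, ← hsupp]
  refine (norm_setIntegral_le_of_norm_le_const hK fun s hs => ?_).trans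
    ((mul_comm _ _).trans_le hlt.le)
  rw [norm_norm, ← dist_eq_norm']
  exact (hiK s hs).le

end UniformConvergence

section CrossedProductMultipliers

open scoped Pointwise

variable {𝕜 : Type v} [RCLike 𝕜]
  {A : Type*} [NonUnitalNormedRing A] [NormedSpace 𝕜 A] [IsScalarTower 𝕜 A A]
  [SMulCommClass 𝕜 A A] [CompleteSpace A]
  {G : Type*} [Group G] [TopologicalSpace G] [IsTopologicalGroup G] [LocallyCompactSpace G]
  [T2Space G] [MeasurableSpace G] [BorelSpace G] (μ : Measure G) [μ.IsHaarMeasure]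
  {α : DynSys 𝕜 A G} {R : UBClass.{v, w} α}

variable (R) in
/-- The canonical map `q^R` on `C_c(G, A)` itself, rather than on its normed copy `CcAlg μ R`. -/
noncomputable def toCP : C_c(G, A) →ₗ[𝕜] CrossedProduct μ R where
  toFun := quot μ R
  map_add' := map_add (quot μ R)
  map_smul' := map_smul (quot μ R)

theorem norm_toCP (f : C_c(G, A)) : ‖toCP μ R f‖ = sigma μ R f := norm_quot μ R f

theorem denseRange_toCP : DenseRange (toCP μ R) := denseRange_quot μ R

theorem intRep_toCP {X : Type*} [NormedAddCommGroup X] [NormedSpace 𝕜 X] [CompleteSpace X]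
    {p : ContCovRep α X} (hp : IsRCont μ R p) (f : C_c(G, A)) :
    intRep μ hp (toCP μ R f) = intForm μ p f := intRep_quot μ hp f

theorem norm_intRep_le {p : Σ X : BanachSp.{v, w} 𝕜, ContCovRep α X} (hp : p ∈ R.carrier)
    (b : CrossedProduct μ R) : ‖intRep μ (isRCont_of_mem μ hp) b‖ ≤ ‖b‖ :=
  (denseRange_toCP μ).induction_on b
    (isClosed_le (continuous_intRep μ _).norm continuous_norm) fun f => by
      rw [intRep_toCP, norm_toCP]
      exact norm_intForm_le_sigma μ R f hp

theorem norm_le_of_norm_intRep_le {b : CrossedProduct μ R} {C : ℝ}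
    (h : ∀ p (hp : p ∈ R.carrier), ‖intRep μ (isRCont_of_mem μ hp) b‖ ≤ C) : ‖b‖ ≤ C := by
  refine le_of_forall_pos_le_add fun ε hε => ?_
  obtain ⟨f, hf⟩ := (denseRange_toCP μ (R := R)).exists_dist_lt b (half_pos hε)
  rw [dist_eq_norm] at hf
  have hfC : ‖toCP μ R f‖ ≤ C + ε / 2 := by
    rw [norm_toCP]
    refine sigma_le μ R fun p hp => ?_
    have hsub := norm_intRep_le μ hp (b - toCP μ R f)
    rw [map_sub, intRep_toCP] at hsub
    exact (norm_le_norm_add_norm_sub _ _).trans (add_le_add (h p hp) (hsub.trans hf.le))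
  linarith [norm_le_norm_add_norm_sub' b (toCP μ R f)]

theorem crossedProduct_ext {b c : CrossedProduct μ R}
    (h : ∀ p (hp : p ∈ R.carrier),
      intRep μ (isRCont_of_mem μ hp) b = intRep μ (isRCont_of_mem μ hp) c) : b = c := by
  refine sub_eq_zero.1 (norm_le_zero_iff.1 (norm_le_of_norm_intRep_le μ fun p hp => ?_))
  rw [map_sub, h p hp, sub_self, norm_zero]

/-- The operator `L` on `C_c(G, A)` acts in every `(π, U)` in `R` as composition with an operator
`S (π, U)` of norm at most `M`. -/
structure IsImplementedBy (R : UBClass.{v, w} α) (L : C_c(G, A) →ₗ[𝕜] C_c(G, A))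
    (S : ∀ p : Σ X : BanachSp.{v, w} 𝕜, ContCovRep α X, p.1 →L[𝕜] p.1) (M : ℝ) : Prop where
  norm_le : ∀ p ∈ R.carrier, ‖S p‖ ≤ M
  intForm_eq : ∀ p ∈ R.carrier, ∀ f, intForm μ p.2 (L f) = S p * intForm μ p.2 f

/-- The extension to the crossed product of a `σ^R`-bounded operator `L` on `C_c(G, A)`. It is a
junk value if `L` is not `σ^R`-bounded. -/
noncomputable def cpExtend (R : UBClass.{v, w} α) (L : C_c(G, A) →ₗ[𝕜] C_c(G, A)) :
    CrossedProduct μ R →L[𝕜] CrossedProduct μ R :=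
  (toCP μ R ∘ₗ L).extendOfNorm (toCP μ R)

namespace IsImplementedBy

variable {μ} {L : C_c(G, A) →ₗ[𝕜] C_c(G, A)}
  {S : ∀ p : Σ X : BanachSp.{v, w} 𝕜, ContCovRep α X, p.1 →L[𝕜] p.1} {M : ℝ}

theorem norm_toCP_le (hL : IsImplementedBy μ R L S M) (f : C_c(G, A)) :
    ‖(toCP μ R ∘ₗ L) f‖ ≤ M * ‖toCP μ R f‖ := by
  rw [LinearMap.comp_apply, norm_toCP, norm_toCP]
  refine sigma_le μ R fun p hp => ?_
  have hS := hL.norm_le p hp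
  rw [hL.intForm_eq p hp]
  exact (norm_mul_le _ _).trans (mul_le_mul hS (norm_intForm_le_sigma μ R f hp) (norm_nonneg _)
    ((norm_nonneg _).trans hS))

theorem cpExtend_toCP (hL : IsImplementedBy μ R L S M) (f : C_c(G, A)) :
    cpExtend μ R L (toCP μ R f) = toCP μ R (L f) :=
  LinearMap.extendOfNorm_eq (f := toCP μ R ∘ₗ L) (e := toCP μ R) (denseRange_toCP μ)
    ⟨M, hL.norm_toCP_le⟩ f

theorem norm_cpExtend_le (hL : IsImplementedBy μ R L S M) : ‖cpExtend μ R L‖ ≤ M := by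
  obtain ⟨p, hp⟩ := R.nonempty
  exact LinearMap.opNorm_extendOfNorm_le (f := toCP μ R ∘ₗ L) (e := toCP μ R) (denseRange_toCP μ)
    ((norm_nonneg _).trans (hL.norm_le p hp)) hL.norm_toCP_le

theorem intRep_cpExtend (hL : IsImplementedBy μ R L S M)
    {p : Σ X : BanachSp.{v, w} 𝕜, ContCovRep α X} (hp : p ∈ R.carrier) (b : CrossedProduct μ R) :
    intRep μ (isRCont_of_mem μ hp) (cpExtend μ R L b) =
      S p * intRep μ (isRCont_of_mem μ hp) b :=
  (denseRange_toCP μ).induction_on b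
    (isClosed_eq ((continuous_intRep μ _).comp (cpExtend μ R L).continuous)
      (continuous_const.mul (continuous_intRep μ _))) fun f => by
    rw [hL.cpExtend_toCP, intRep_toCP, intRep_toCP, hL.intForm_eq p hp]

theorem isLeftMultiplier (hL : IsImplementedBy μ R L S M) :
    IsLeftMultiplier (cpExtend μ R L) := fun b c =>
  crossedProduct_ext μ fun p hp => by
    rw [hL.intRep_cpExtend hp, map_mul, map_mul, hL.intRep_cpExtend hp, mul_assoc]

end IsImplementedBy

/-- Every `(π, U)` in `R` consists of contractions. -/
def UBClass.IsContractive (R : UBClass.{v, w} α) : Prop :=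
  ∀ p ∈ R.carrier, (∀ a, ‖p.2.π a‖ ≤ ‖a‖) ∧ ∀ r, ‖p.2.U r‖ ≤ 1

theorem norm_toCP_le_integral (hR : R.IsContractive) (f : C_c(G, A)) :
    ‖toCP μ R f‖ ≤ ∫ s, ‖f s‖ ∂μ := by
  rw [norm_toCP]
  refine sigma_le μ R fun p hp => ContinuousLinearMap.opNorm_le_bound _ (by positivity) fun x => ?_
  have hπ : ∀ a, ‖p.2.π a‖ ≤ 1 * ‖a‖ := by simpa only [one_mul] using (hR p hp).1
  have hle := norm_intForm_le μ p.2 f zero_le_one hπ (fun s _ => (hR p hp).2 s) x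
  rwa [one_mul, one_mul] at hle

theorem tendsto_toCP (hR : R.IsContractive) {ι : Type*} {l : Filter ι} {F : ι → C_c(G, A)}
    {f : C_c(G, A)} {K : Set G} (hK : IsCompact K) (hF : ∀ᶠ i in l, ∀ s ∉ K, F i s = f s)
    (h : TendstoUniformlyOn (fun i => F i) f l K) :
    Tendsto (fun i => toCP μ R (F i)) l (𝓝 (toCP μ R f)) := by
  rw [tendsto_iff_norm_sub_tendsto_zero]
  refine squeeze_zero (fun _ => norm_nonneg _) (fun i => ?_)
    (tendsto_integral_norm_sub_of_tendstoUniformlyOn (μ := μ) hK.measure_lt_top hF h)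
  rw [← map_sub]
  exact norm_toCP_le_integral μ hR (F i - f)

theorem tendsto_toCP_ccTranslate (hR : R.IsContractive) (f : C_c(G, A)) (t : G) :
    Tendsto (fun s => toCP μ R (ccTranslate α s f)) (𝓝 t) (𝓝 (toCP μ R (ccTranslate α t f))) := by
  obtain ⟨N, hN, hNt⟩ := exists_compact_mem_nhds t
  have hK : IsCompact (N * tsupport f) := hN.mul f.hasCompactSupport.isCompact
  have hzero : ∀ s ∈ N, ∀ r ∉ N * tsupport f, ccTranslate α s f r = 0 := fun s hs r hr => by
    have hsr : s⁻¹ * r ∉ tsupport f := fun h => hr ⟨s, hs, s⁻¹ * r, h, mul_inv_cancel_left s r⟩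
    exact (congrArg (α.act s) (image_eq_zero_of_notMem_tsupport hsr)).trans (map_zero _)
  refine tendsto_toCP μ hR hK ?_ fun u hu => ?_
  · filter_upwards [hNt] with s hs r hr
    rw [hzero s hs r hr, hzero t (mem_of_mem_nhds hNt) r hr]
  · have hcont : Continuous (Function.uncurry fun s r => ccTranslate α s f r) :=
      α.continuous_joint.comp (f := fun q : G × G => (q.1, f (q.1⁻¹ * q.2))) (by fun_prop)
    obtain ⟨v, hv, hvu⟩ :=
      hK.mem_uniformity_of_prod hcont.continuousOn (mem_univ t) (symm_le_uniformity hu)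
    exact eventually_of_mem (nhdsWithin_univ t ▸ hv) hvu

theorem tendsto_toCP_ccMulLeft (hR : R.IsContractive) {l : Filter A} {M : ℝ}
    (hM : ∀ᶠ u in l, ‖u‖ ≤ M) (hl : ∀ a, Tendsto (fun u => u * a) l (𝓝 a)) (f : C_c(G, A)) :
    Tendsto (fun u => toCP μ R (ccMulLeft (𝕜 := 𝕜) u f)) l (𝓝 (toCP μ R f)) := by
  have hunif := tendstoUniformlyOn_of_isCompact (Ψ := ContinuousLinearMap.mul 𝕜 A)
    (Φ := ContinuousLinearMap.id 𝕜 A)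
    (hM.mono fun u hu => (ContinuousLinearMap.opNorm_mul_apply_le 𝕜 A u).trans hu) hl
    (f.hasCompactSupport.isCompact_range f.continuous)
  refine tendsto_toCP μ hR f.hasCompactSupport (.of_forall fun u s hs => ?_)
    ((hunif.comp f).mono fun s _ => mem_range_self s)
  have hfs : f s = 0 := image_eq_zero_of_notMem_tsupport hs
  exact (congrArg (u * ·) hfs).trans ((mul_zero u).trans hfs.symm)

end CrossedProductMultipliers

section CanonicalRepresentation

variable {𝕜 : Type v} [RCLike 𝕜]
  {A : Type*} [NonUnitalNormedRing A] [NormedSpace 𝕜 A] [IsScalarTower 𝕜 A A]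
  [SMulCommClass 𝕜 A A] [CompleteSpace A]
  {G : Type*} [Group G] [TopologicalSpace G] [IsTopologicalGroup G] [LocallyCompactSpace G]
  [T2Space G] [MeasurableSpace G] [BorelSpace G] (μ : Measure G) [μ.IsHaarMeasure]
  {α : DynSys 𝕜 A G} {R : UBClass.{v, w} α}

namespace UBClass.IsContractive

theorem isImplementedBy_ccMulLeft (hR : R.IsContractive) (a : A) :
    IsImplementedBy μ R (ccMulLeft a) (fun p => p.2.π a) ‖a‖ :=
  ⟨fun p hp => (hR p hp).1 a, fun p _ => intForm_ccMulLeft μ p.2 a⟩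

theorem isImplementedBy_ccTranslate (hR : R.IsContractive) (t : G) :
    IsImplementedBy μ R (ccTranslate α t) (fun p => p.2.U t) 1 :=
  ⟨fun p hp => (hR p hp).2 t, fun p _ => intForm_ccTranslate μ p.2 t⟩

variable {p : Σ X : BanachSp.{v, w} 𝕜, ContCovRep α X}

theorem intRep_cpExtend_ccMulLeft (hR : R.IsContractive) (hp : p ∈ R.carrier) (a : A)
    (b : CrossedProduct μ R) :
    intRep μ (isRCont_of_mem μ hp) (cpExtend μ R (ccMulLeft a) b) =
      p.2.π a * intRep μ (isRCont_of_mem μ hp) b :=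
  (hR.isImplementedBy_ccMulLeft μ a).intRep_cpExtend hp b

theorem intRep_cpExtend_ccTranslate (hR : R.IsContractive) (hp : p ∈ R.carrier) (t : G)
    (b : CrossedProduct μ R) :
    intRep μ (isRCont_of_mem μ hp) (cpExtend μ R (ccTranslate α t) b) =
      p.2.U t * intRep μ (isRCont_of_mem μ hp) b :=
  (hR.isImplementedBy_ccTranslate μ t).intRep_cpExtend hp b

theorem continuous_cpExtend_ccTranslate (hR : R.IsContractive) (b : CrossedProduct μ R) :
    Continuous fun t => cpExtend μ R (ccTranslate α t) b := by
  refine continuous_iff_continuousAt.2 fun t => ?_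
  refine tendsto_clm_apply_of_dense_span (.of_forall fun s =>
    (hR.isImplementedBy_ccTranslate μ s).norm_cpExtend_le)
    ((denseRange_toCP μ).mono Submodule.subset_span) ?_ b
  rintro _ ⟨f, rfl⟩
  simp only [(hR.isImplementedBy_ccTranslate μ _).cpExtend_toCP]
  exact tendsto_toCP_ccTranslate μ hR f t

/-- The canonical covariant representation `(i_A, i_G)` on the crossed product by left
multipliers. -/
noncomputable def cpRep (hR : R.IsContractive) : ContCovRep α (CrossedProduct μ R) where
  π :=
    { toFun := fun a => cpExtend μ R (ccMulLeft a)
      map_smul' := fun c a => ContinuousLinearMap.ext fun b => crossedProduct_ext μ fun p hp => by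
        simp [intRep_cpExtend_ccMulLeft μ hR hp, map_smul]
      map_zero' := ContinuousLinearMap.ext fun b => crossedProduct_ext μ fun p hp => by
        simp [intRep_cpExtend_ccMulLeft μ hR hp]
      map_add' := fun a a' => ContinuousLinearMap.ext fun b => crossedProduct_ext μ fun p hp => by
        simp [intRep_cpExtend_ccMulLeft μ hR hp, add_mul]
      map_mul' := fun a a' => ContinuousLinearMap.ext fun b => crossedProduct_ext μ fun p hp => by
        simp [intRep_cpExtend_ccMulLeft μ hR hp, mul_assoc] }
  U :=
    { toFun := fun t => cpExtend μ R (ccTranslate α t)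
      map_one' := ContinuousLinearMap.ext fun b => crossedProduct_ext μ fun p hp => by
        simp [intRep_cpExtend_ccTranslate μ hR hp]
      map_mul' := fun s t => ContinuousLinearMap.ext fun b => crossedProduct_ext μ fun p hp => by
        simp [intRep_cpExtend_ccTranslate μ hR hp, mul_assoc] }
  covariant a s := ContinuousLinearMap.ext fun b => crossedProduct_ext μ fun p hp => by
    simp [intRep_cpExtend_ccMulLeft μ hR hp, intRep_cpExtend_ccTranslate μ hR hp, mul_assoc,
      p.2.covariant]
  bounded := ⟨1, fun a => (one_mul ‖a‖).symm ▸
    (hR.isImplementedBy_ccMulLeft μ a).norm_cpExtend_le⟩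
  continuous_U := hR.continuous_cpExtend_ccTranslate μ

theorem norm_cpRep_π_le (hR : R.IsContractive) (a : A) : ‖(hR.cpRep μ).π a‖ ≤ ‖a‖ :=
  (hR.isImplementedBy_ccMulLeft μ a).norm_cpExtend_le

theorem norm_cpRep_U_le (hR : R.IsContractive) (t : G) : ‖(hR.cpRep μ).U t‖ ≤ 1 :=
  (hR.isImplementedBy_ccTranslate μ t).norm_cpExtend_le

theorem isLeftMultiplier_cpRep_π (hR : R.IsContractive) (a : A) :
    IsLeftMultiplier ((hR.cpRep μ).π a) :=
  (hR.isImplementedBy_ccMulLeft μ a).isLeftMultiplier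

theorem isLeftMultiplier_cpRep_U (hR : R.IsContractive) (t : G) :
    IsLeftMultiplier ((hR.cpRep μ).U t) :=
  (hR.isImplementedBy_ccTranslate μ t).isLeftMultiplier

theorem intForm_cpRep (hR : R.IsContractive) (f : C_c(G, A)) (b : CrossedProduct μ R) :
    intForm μ (hR.cpRep μ) f b = toCP μ R f * b := by
  refine crossedProduct_ext μ fun p hp => ContinuousLinearMap.ext fun x => ?_
  let Φ : CrossedProduct μ R →L[𝕜] p.1 :=
    (ContinuousLinearMap.apply 𝕜 p.1 x).comp (intRepL μ (isRCont_of_mem μ hp))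
  have hπ : Intertwines (hR.cpRep μ).π p.2.π Φ := fun a => ContinuousLinearMap.ext fun c =>
    (DFunLike.congr_fun (hR.intRep_cpExtend_ccMulLeft μ hp a c) x).symm
  have hU : Intertwines (hR.cpRep μ).U p.2.U Φ := fun t => ContinuousLinearMap.ext fun c =>
    (DFunLike.congr_fun (hR.intRep_cpExtend_ccTranslate μ hp t c) x).symm
  rw [map_mul, intRep_toCP]
  exact (DFunLike.congr_fun (hπ.intForm μ hU f) b).symm

theorem tendsto_cpRep_π (hR : R.IsContractive) {l : Filter A} {M : ℝ} (hM : ∀ᶠ u in l, ‖u‖ ≤ M)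
    (hl : ∀ a, Tendsto (fun u => u * a) l (𝓝 a)) (b : CrossedProduct μ R) :
    Tendsto (fun u => (hR.cpRep μ).π u b) l (𝓝 b) := by
  refine tendsto_clm_apply_of_dense_span (Φ := ContinuousLinearMap.id 𝕜 _)
    (hM.mono fun u hu => (hR.norm_cpRep_π_le μ u).trans hu)
    ((denseRange_toCP μ).mono Submodule.subset_span) ?_ b
  rintro _ ⟨f, rfl⟩
  exact (tendsto_toCP_ccMulLeft μ hR hM hl f).congr fun u =>
    ((hR.isImplementedBy_ccMulLeft μ u).cpExtend_toCP f).symm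

theorem norm_toCP_ccTensor_le (hR : R.IsContractive) {V : Set G} {φ : C_c(G, ℝ)}
    (hφ : φ ∈ bumps μ V) (a : A) : ‖toCP μ R (ccTensor 𝕜 φ a)‖ ≤ ‖a‖ :=
  (norm_toCP_le_integral μ hR _).trans (integral_norm_ofReal_smul_le 𝕜 hφ fun _ _ => le_rfl)

theorem hasApproxLeftId (hR : R.IsContractive) {M : ℝ} (hA : HasApproxLeftId A M) :
    HasApproxLeftId (CrossedProduct μ R) M := by
  obtain ⟨l, _, hM, hlim⟩ := hA
  refine ⟨(bumpFilter μ ×ˢ l).map fun q => toCP μ R (ccTensor 𝕜 q.1 q.2), inferInstance, ?_,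
    fun b => ?_⟩
  · rw [eventually_map]
    filter_upwards [(eventually_mem_bumps μ univ_mem).prod_mk hM] with q hq
    exact (hR.norm_toCP_ccTensor_le μ hq.1 q.2).trans hq.2
  · simp only [tendsto_map'_iff, Function.comp_def, ← hR.intForm_cpRep μ]
    exact tendsto_intForm_ccTensor_approxLeftId μ _ hM (hR.tendsto_cpRep_π μ hM hlim b)

end UBClass.IsContractive

end CanonicalRepresentation

section IsometricClass

variable {𝕜 : Type v} [RCLike 𝕜] {A : Type*} [NonUnitalNormedRing A] [NormedSpace 𝕜 A]
  {G : Type*} [Group G] [TopologicalSpace G] {α : DynSys 𝕜 A G} {𝒳 : Set (BanachSp.{v, w} 𝕜)}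

theorem isContractive_isomClass (hne : (isomSet α 𝒳).Nonempty) :
    (isomClass α 𝒳 hne).IsContractive := fun p hp =>
  ⟨hp.2.2.1, fun r => ContinuousLinearMap.opNorm_le_bound _ zero_le_one fun x => by
    rw [one_mul, (AddMonoidHomClass.isometry_iff_norm (p.2.U r)).1 (hp.2.2.2 r)]⟩

end IsometricClass

section Correspondence

variable {𝕜 : Type v} [RCLike 𝕜]
  {A : Type*} [NonUnitalNormedRing A] [NormedSpace 𝕜 A] [IsScalarTower 𝕜 A A]
  [SMulCommClass 𝕜 A A] [CompleteSpace A]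
  {G : Type*} [Group G] [TopologicalSpace G] [IsTopologicalGroup G] [LocallyCompactSpace G]
  [T2Space G] [MeasurableSpace G] [BorelSpace G] (μ : Measure G) [μ.IsHaarMeasure]
  {α : DynSys 𝕜 A G} {R : UBClass.{v, w} α}
  {X : Type*} [NormedAddCommGroup X] [NormedSpace 𝕜 X] [CompleteSpace X]

theorem intForm_eq_of_apply_cpRep (hR : R.IsContractive) {p : ContCovRep α X}
    {T : CrossedProduct μ R →ₙₐ[𝕜] (X →L[𝕜] X)} (hT : Nondeg T) (hTc : Continuous T)
    (hπ : ∀ a b x, p.π a (T b x) = T ((hR.cpRep μ).π a b) x)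
    (hU : ∀ s b x, p.U s (T b x) = T ((hR.cpRep μ).U s b) x) (f : C_c(G, A)) :
    intForm μ p f = T (toCP μ R f) := by
  refine hT.ext fun b x => ?_
  let TL : CrossedProduct μ R →L[𝕜] (X →L[𝕜] X) := ⟨(T : CrossedProduct μ R →ₗ[𝕜] _), hTc⟩
  let Φ : CrossedProduct μ R →L[𝕜] X := (ContinuousLinearMap.apply 𝕜 X x).comp TL
  have hΦπ : Intertwines (hR.cpRep μ).π p.π Φ := fun a =>
    ContinuousLinearMap.ext fun c => hπ a c x
  have hΦU : Intertwines (hR.cpRep μ).U p.U Φ := fun s =>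
    ContinuousLinearMap.ext fun c => hU s c x
  calc intForm μ p f (T b x)
      = T (intForm μ (hR.cpRep μ) f b) x := DFunLike.congr_fun (hΦπ.intForm μ hΦU f) b
    _ = T (toCP μ R f) (T b x) := by
      rw [hR.intForm_cpRep μ, map_mul, mul_apply_eq_comp]

theorem UBClass.IsContractive.exists_intForm_eq (hR : R.IsContractive)
    (hA : ∀ ε : ℝ, 0 < ε → HasApproxLeftId A (1 + ε))
    {T : CrossedProduct μ R →ₙₐ[𝕜] (X →L[𝕜] X)} (hT : Nondeg T) (hb : ∀ b, ‖T b‖ ≤ ‖b‖) :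
    ∃ p : ContCovRep α X, Nondeg p.π ∧ (∀ a, ‖p.π a‖ ≤ ‖a‖) ∧ (∀ r, Isometry (p.U r)) ∧
      ∀ f, intForm μ p f = T (toCP μ R f) := by
  have hTc : Continuous T := AddMonoidHomClass.continuous_of_bound T 1 (by simpa using hb)
  obtain ⟨p, hπ, hU, hπ_norm, hU_norm⟩ := exists_contCovRep_of_isLeftMultiplier
    (hR.isLeftMultiplier_cpRep_π μ) (hR.isLeftMultiplier_cpRep_U μ)
    (fun ε hε => hR.hasApproxLeftId μ (hA ε hε)) hT hb
  obtain ⟨l, _, hM, hl⟩ := hA 1 one_pos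
  refine ⟨p, hT.of_mem_closure fun b x => ?_, fun a => (hπ_norm a).trans (hR.norm_cpRep_π_le μ a),
    isometry_of_norm_le_one p.U fun s => (hU_norm s).trans (hR.norm_cpRep_U_le μ s),
    intForm_eq_of_apply_cpRep μ hR hT hTc hπ hU⟩
  have hlim : Tendsto (fun u => T ((hR.cpRep μ).π u b) x) l (𝓝 (T b x)) :=
    ((hTc.clm_apply continuous_const).tendsto b).comp (hR.tendsto_cpRep_π μ hM hl b)
  exact mem_closure_of_tendsto hlim (.of_forall fun u => ⟨u, T b x, hπ u b x⟩)

theorem nondeg_intRep {p : ContCovRep α X} (hp : IsRCont μ R p) (hπ : Nondeg p.π) :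
    Nondeg (intRep μ hp) := by
  refine (nondeg_intForm μ hπ).of_mem_closure fun f x => subset_closure ⟨toCP μ R f, x, ?_⟩
  rw [intRep_toCP]

theorem intRep_eq_of_intForm_eq {p : ContCovRep α X} (hp : IsRCont μ R p)
    {T : CrossedProduct μ R →ₙₐ[𝕜] (X →L[𝕜] X)} (hT : Continuous T)
    (h : ∀ f, intForm μ p f = T (toCP μ R f)) : intRep μ hp = T :=
  DFunLike.coe_injective <| (denseRange_toCP μ).equalizer (continuous_intRep μ hp) hT <|
    funext fun f => (intRep_toCP μ hp f).trans (h f)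

theorem covRep_ext_of_intRep {p q : ContCovRep α X} (hπ : Nondeg p.π) (hp : IsRCont μ R p)
    (hq : IsRCont μ R q) (h : intRep μ hp = intRep μ hq) : p = q :=
  covRep_ext_of_intForm μ hπ fun f => by rw [← intRep_toCP μ hp, h, intRep_toCP]

theorem invariant_intRep_iff {p : ContCovRep α X} (hp : IsRCont μ R p) {Z : Submodule 𝕜 X}
    (hZ : IsClosed (Z : Set X)) :
    Invariant (intForm μ p) Z ↔ Invariant (intRep μ hp) Z := by
  refine ⟨fun h b => (denseRange_toCP μ).induction_on b
    (isClosed_setOf_mapsTo (continuous_intRep μ hp) hZ) fun f => ?_, fun h f => ?_⟩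
  · rw [← intRep_toCP μ hp]
    exact h _
  · rw [intRep_toCP]
    exact h f

theorem intertwines_intRep_iff {Y : Type*} [NormedAddCommGroup Y] [NormedSpace 𝕜 Y]
    [CompleteSpace Y] {p : ContCovRep α X} (hp : IsRCont μ R p) {q : ContCovRep α Y}
    (hq : IsRCont μ R q) (Φ : X →L[𝕜] Y) :
    Intertwines (intForm μ p) (intForm μ q) Φ ↔
      Intertwines (intRep μ hp) (intRep μ hq) Φ := by
  refine ⟨fun h b => (denseRange_toCP μ).induction_on b
    (isClosed_eq ((continuous_intRep μ hq).clm_comp continuous_const)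
      (continuous_const.clm_comp (continuous_intRep μ hp))) fun f => ?_, fun h f => ?_⟩
  · rw [← intRep_toCP μ hp, ← intRep_toCP μ hq]
    exact h _
  · rw [intRep_toCP, intRep_toCP]
    exact h f

theorem continuous_cpStar [StarRing A] [ContinuousStar A] : Continuous (cpStar μ R) :=
  UniformSpace.Completion.continuous_map

theorem isInvolutiveRep_intRep [StarRing A] [StarModule 𝕜 A] [ContinuousStar A]
    (hR : R.IsInvolutive) {p : ContCovRep α X} (hp : IsRCont μ R p)
    (hinv : p.toCovRep.IsInvolutive) : IsInvolutiveRep μ R (intRep μ hp) := by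
  obtain ⟨h, rfl, hπ, hU⟩ := hinv
  refine ⟨h, rfl, fun b x y => ?_⟩
  have hc := continuous_intRep μ hp
  have hclosed : IsClosed {b | h.inner (intRep μ hp (cpStar μ R b) x) y =
      h.inner x (intRep μ hp b y)} :=
    isClosed_eq
      (((hc.comp (continuous_cpStar μ)).clm_apply continuous_const).inner (𝕜 := 𝕜)
        continuous_const)
      (continuous_const.inner (𝕜 := 𝕜) (hc.clm_apply continuous_const))
  refine (denseRange_toCP μ).induction_on b hclosed fun f => ?_
  have hstar : cpStar μ R (toCP μ R f) = toCP μ R (ccStar α f) := cpStar_quot μ R hR f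
  rw [hstar, intRep_toCP, intRep_toCP]
  exact inner_ccStar μ p h rfl hπ hU f x y

variable {𝒳 : Set (BanachSp.{v, w} 𝕜)} (hne : (isomSet α 𝒳).Nonempty)

theorem injective_integration : Function.Injective (integration μ (isomClass α 𝒳 hne)) := by
  rintro ⟨⟨X, p⟩, hp⟩ ⟨⟨Y, q⟩, hq⟩ h
  obtain ⟨rfl, hrep⟩ := Sigma.mk.inj h
  obtain rfl : p = q := covRep_ext_of_intRep μ hp.2.1 _ _ (eq_of_heq hrep)
  rfl

theorem bijOn_integration (hA : ∀ ε : ℝ, 0 < ε → HasApproxLeftId A (1 + ε)) :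
    BijOn (integration μ (isomClass α 𝒳 hne)) univ
      {T : CPRep.{v, w} μ (isomClass α 𝒳 hne) | T.1 ∈ 𝒳 ∧ Nondeg T.2 ∧ ∀ b, ‖T.2 b‖ ≤ ‖b‖} := by
  refine ⟨fun p _ => ⟨p.2.1, nondeg_intRep μ _ p.2.2.1, fun b => norm_intRep_le μ p.2 b⟩,
    (injective_integration μ hne).injOn, ?_⟩
  rintro ⟨X, T⟩ ⟨hX, hT, hb⟩
  obtain ⟨p, hπ, hπ_norm, hU, hT_eq⟩ :=
    (isContractive_isomClass hne).exists_intForm_eq μ hA hT hb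
  have hTc : Continuous T := AddMonoidHomClass.continuous_of_bound T 1 (by simpa using hb)
  exact ⟨⟨⟨X, p⟩, hX, hπ, hπ_norm, hU⟩, mem_univ _,
    congrArg (Sigma.mk X) (intRep_eq_of_intForm_eq μ _ hTc hT_eq)⟩

end Correspondence

end CrossedProd

theorem theoremt_general {𝕜 : Type v} [RCLike 𝕜]
    {A : Type*} [NonUnitalNormedRing A] [NormedSpace 𝕜 A] [IsScalarTower 𝕜 A A]
    [SMulCommClass 𝕜 A A] [CompleteSpace A]
    {G : Type*} [Group G] [TopologicalSpace G] [IsTopologicalGroup G] [LocallyCompactSpace G]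
    [T2Space G] [MeasurableSpace G] [BorelSpace G] (μ : Measure G) [μ.IsHaarMeasure]
    (α : CrossedProd.DynSys 𝕜 A G)
    (hA : ∀ ε : ℝ, 0 < ε → CrossedProd.HasApproxLeftId A (1 + ε))
    (𝒳 : Set (CrossedProd.BanachSp.{v, w} 𝕜)) (hne : (CrossedProd.isomSet α 𝒳).Nonempty) :
    let R := CrossedProd.isomClass α 𝒳 hne
    Set.BijOn (CrossedProd.integration μ R) Set.univ
      {T : CrossedProd.CPRep.{v, w} μ R |
        T.1 ∈ 𝒳 ∧ CrossedProd.Nondeg T.2 ∧ ∀ b, ‖T.2 b‖ ≤ ‖b‖} ∧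
    (∀ (p : R.carrier) (Z : Submodule 𝕜 p.1.1), IsClosed (Z : Set p.1.1) →
      (CrossedProd.Invariant p.1.2.π Z ∧ CrossedProd.Invariant p.1.2.U Z ↔
        CrossedProd.Invariant (CrossedProd.integration μ R p).2 Z)) ∧
    (∀ (p q : R.carrier) (Φ : p.1.1 →L[𝕜] q.1.1),
      CrossedProd.Intertwines p.1.2.π q.1.2.π Φ ∧ CrossedProd.Intertwines p.1.2.U q.1.2.U Φ ↔
        CrossedProd.Intertwines (CrossedProd.integration μ R p).2
          (CrossedProd.integration μ R q).2 Φ) ∧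
    (∀ [StarRing A] [StarModule 𝕜 A] [ContinuousStar A], R.IsInvolutive →
      ∀ p : R.carrier, p.1.2.IsInvolutive ↔
        CrossedProd.IsInvolutiveRep μ R (CrossedProd.integration μ R p).2) := by
  intro R
  refine ⟨CrossedProd.bijOn_integration μ hne hA, fun p Z hZ => ?_, fun p q Φ => ?_,
    fun hinv p => ?_⟩
  · exact (CrossedProd.invariant_intForm_iff μ p.2.2.1 (hA 1 one_pos) hZ).trans
      (CrossedProd.invariant_intRep_iff μ (CrossedProd.isRCont_of_mem μ p.2) hZ)
  · exact (CrossedProd.intertwines_intForm_iff μ p.2.2.1 Φ).trans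
      (CrossedProd.intertwines_intRep_iff μ (CrossedProd.isRCont_of_mem μ p.2)
        (CrossedProd.isRCont_of_mem μ q.2) Φ)
  · exact ⟨CrossedProd.isInvolutiveRep_intRep μ hinv (CrossedProd.isRCont_of_mem μ p.2),
      fun _ => hinv p.1 p.2⟩

theorem theoremt {𝕜 : Type v} [RCLike 𝕜]
    {A : Type*} [NonUnitalNormedRing A] [NormedSpace 𝕜 A] [IsScalarTower 𝕜 A A]
    [SMulCommClass 𝕜 A A] [CompleteSpace A]
    {G : Type*} [Group G] [TopologicalSpace G] [IsTopologicalGroup G] [LocallyCompactSpace G]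
    [T2Space G] [MeasurableSpace G] [BorelSpace G] (μ : Measure G) [μ.IsHaarMeasure]
    (α : CrossedProd.DynSys 𝕜 A G)
    (hA : ∀ ε : ℝ, 0 < ε → CrossedProd.HasApproxLeftId A (1 + ε))
    (𝒳 : Set (CrossedProd.BanachSp.{v, w} 𝕜)) (hne : (CrossedProd.isomSet α 𝒳).Nonempty) :
    let R := CrossedProd.isomClass α 𝒳 hne
    Set.BijOn (CrossedProd.integration μ R) Set.univ
      {T : CrossedProd.CPRep.{v, w} μ R |
        T.1 ∈ 𝒳 ∧ CrossedProd.Nondeg T.2 ∧ ∀ b, ‖T.2 b‖ ≤ ‖b‖} ∧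
    (∀ (p : R.carrier) (Z : Submodule 𝕜 p.1.1), IsClosed (Z : Set p.1.1) →
      (CrossedProd.Invariant p.1.2.π Z ∧ CrossedProd.Invariant p.1.2.U Z ↔
        CrossedProd.Invariant (CrossedProd.integration μ R p).2 Z)) ∧
    (∀ (p q : R.carrier) (Φ : p.1.1 →L[𝕜] q.1.1),
      CrossedProd.Intertwines p.1.2.π q.1.2.π Φ ∧ CrossedProd.Intertwines p.1.2.U q.1.2.U Φ ↔
        CrossedProd.Intertwines (CrossedProd.integration μ R p).2
          (CrossedProd.integration μ R q).2 Φ) ∧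
    (∀ [StarRing A] [StarModule 𝕜 A] [ContinuousStar A], α.IsInvolutive → R.IsInvolutive →
      ∀ p : R.carrier, p.1.2.IsInvolutive ↔
        CrossedProd.IsInvolutiveRep μ R (CrossedProd.integration μ R p).2) := by
  obtain ⟨hbij, hZ, hΦ, hinv⟩ := theoremt_general μ α hA 𝒳 hne
  exact ⟨hbij, hZ, hΦ, fun _ => hinv⟩
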